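/- Let $\Omega=\{0,1\}^{\mathbb N}$, let $\sigma$ be the left shift, and let $2<\delta<\gamma$. Let $g:\Omega\to\mathbb R$ be the double Hofbauer potential: for $n\ge 2$, $g=-\gamma\log\frac{n}{n-1}$ on the cylinder $[0^n1]$ and $g=-\delta\log\frac{n}{n-1}$ on $[1^n0]$; $g=-\log\zeta(\gamma)$ on $[01]$, $g=-\log\zeta(\delta)$ on $[10]$, and $g(0^\infty)=g(1^\infty)=0$. Let $\mathcal L_g\psi(x)=\sum_{\sigma y=x}e^{g(y)}\psi(y)$ be its Ruelle operator at the critical inverse temperature $\beta=1$, and let $\varphi_1:\Omega\to(0,\infty]$ be its eigenfunction $$\varphi_1(0^n1\ldots)=1+n^{\gamma}\sum_{j\ge2}(n+j-1)^{-\gamma},\qquad \varphi_1(1^n0\ldots)=1+n^{\delta}\sum_{j\ge2}(n+j-1)^{-\delta}\quad(n\ge 1),\qquad \varphi_1(0^\infty)=\varphi_1(1^\infty)=\infty .$$ Then there is a Borel probability measure $\nu_1$ on $\Omega$ with $\mathcal L_g^*\nu_1=\nu_1$ for which $0<\int\varphi_1\,d\nu_1<\infty$, so that the equilibrium probability $\mu_1=\varphi_1\nu_1/\int\varphi_1\,d\nu_1$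 is defined; every $\mu_1$ so obtained is a $\sigma$-invariant probability measure, and the correlations of the indicator $I_{[0]}$ of the cylinder $[0]=\{x: x_0=0\}$ under $\mu_1$ decay polynomially, with $$\int_\Omega (I_{[0]}\circ\sigma^q)\,\bigl(I_{[0]}-\mu_1[0]\bigr)\,d\mu_1\;\sim\;q^{2-\delta}\qquad(q\to\infty),$$ in the sense that there is a constant $C>0$, depending only on $\gamma$ and $\delta$, such that $$\lim_{q\to\infty}\;q^{\delta-2}\int_\Omega (I_{[0]}\circ\sigma^q)\,\bigl(I_{[0]}-\mu_1[0]\bigr)\,d\mu_1=C .$$ -/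

import Mathlib

open MeasureTheory Filter Topology
open scoped ENNReal

namespace DoubleHofbauer

/-- The symbolic space `{0,1}^ℕ`, with its product topology and its product (= Borel) σ-algebra. -/
abbrev Omega : Type := ℕ → Fin 2

/-- The left shift `σ`. -/
def shift (x : Omega) : Omega := fun n => x (n + 1)

/-- The sequence `a x₀ x₁ x₂ …`. -/
def prepend (a : Fin 2) (x : Omega) : Omega
  | 0 => a
  | n + 1 => x n

/-- The preimages of `x` under the shift are exactly `0x` and `1x`. -/
theorem shift_eq_iff (x y : Omega) : shift y = x ↔ ∃ a : Fin 2, y = prepend a x := by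
  constructor
  · rintro rfl
    exact ⟨y 0, funext fun n => by cases n <;> rfl⟩
  · rintro ⟨a, rfl⟩
    rfl

/-- The two preimages are different, so that each is counted once in `ruelle`. -/
theorem prepend_injective (x : Omega) : Function.Injective fun a => prepend a x :=
  fun _ _ h => congrFun h 0

/-- The length of the first block of equal symbols of `x`: it is `n ≥ 1` if `x` begins with
`0ⁿ1` or `1ⁿ0`, and by convention `0` if `x` is one of the two constant sequences. -/
noncomputable def firstBlock (x : Omega) : ℕ := sInf {n | x n ≠ x 0}

theorem firstBlock_eq {a : Fin 2} {n : ℕ} (hn : 1 ≤ n) {x : Omega}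
    (h : ∀ i < n, x i = a) (h' : x n ≠ a) : x 0 = a ∧ firstBlock x = n := by
  have h0 : x 0 = a := h 0 hn
  refine ⟨h0, le_antisymm (Nat.sInf_le (by simpa [h0] using h')) ?_⟩
  refine le_csInf ⟨n, by simpa [h0] using h'⟩ fun m hm => ?_
  by_contra hlt
  exact hm (by rw [h m (not_le.mp hlt), h0])

theorem firstBlock_eq_zero_iff (x : Omega) : firstBlock x = 0 ↔ ∀ n, x n = x 0 := by
  constructor
  · intro h n
    rcases Nat.sInf_eq_zero.mp h with h | h
    · exact absurd rfl h
    · by_contra hn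
      have : n ∈ {n | x n ≠ x 0} := hn
      rw [h] at this
      exact this
  · intro h
    refine Nat.sInf_eq_zero.mpr (Or.inr ?_)
    ext n
    simpa using h n

/-- `ζ(s) = ∑_{n ≥ 1} 1 / n ^ s` for real `s > 1`. -/
noncomputable def zeta (s : ℝ) : ℝ := ∑' n : ℕ, 1 / ((n : ℝ) + 1) ^ s

/-- The exponent attached to the first symbol: `γ` for `0`, `δ` for `1`. -/
noncomputable def exponent (γ δ : ℝ) (x : Omega) : ℝ := if x 0 = 0 then γ else δ

/-- The double Hofbauer potential: `-s log (n / (n - 1))` if the first block has length `n ≥ 2`,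
`-log ζ(s)` if it has length `1`, and `0` at the constant sequences, where `s = γ` on the
sequences beginning with `0` and `s = δ` on those beginning with `1`. -/
noncomputable def potential (γ δ : ℝ) (x : Omega) : ℝ :=
  if firstBlock x = 0 then 0
  else if firstBlock x = 1 then -Real.log (zeta (exponent γ δ x))
  else -(exponent γ δ x) * Real.log ((firstBlock x : ℝ) / ((firstBlock x : ℝ) - 1))

/-- The Ruelle operator `(𝓛_f ψ)(x) = ∑_{σ y = x} e^{f y} ψ y`. -/
noncomputable def ruelle (f ψ : Omega → ℝ) (x : Omega) : ℝ :=
  ∑ a : Fin 2, Real.exp (f (prepend a x)) * ψ (prepend a x)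

/-- `𝓛_f^* ν = ν`: the measure `ν` is fixed by the dual of the Ruelle operator. -/
def IsRuelleFixed (f : Omega → ℝ) (ν : Measure Omega) : Prop :=
  ∀ ψ : Omega → ℝ, Continuous ψ → ∫ x, ruelle f ψ x ∂ν = ∫ x, ψ x ∂ν

/-- The positive eigenfunction `φ₁` of the Ruelle operator of the double Hofbauer potential at
inverse temperature `1`: it is `1 + n ^ s ∑_{j ≥ 2} (n + j - 1) ^ (-s)` if the first block has
length `n ≥ 1` (with `s` as above) and `∞` at the two constant sequences. -/
noncomputable def eigenfunction (γ δ : ℝ) (x : Omega) : ℝ≥0∞ :=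
  if firstBlock x = 0 then ⊤
  else ENNReal.ofReal (1 + (firstBlock x : ℝ) ^ (exponent γ δ x) *
    ∑' j : ℕ, ((firstBlock x : ℝ) + 1 + (j : ℝ)) ^ (-(exponent γ δ x)))

/-- `μ` is the measure `μ₁ = φ₁ ν₁`, normalized to total mass one, where `ν₁` is a probability
measure with `𝓛_g^* ν₁ = ν₁`, for the double Hofbauer potential `g`. -/
def IsCriticalEquilibrium (γ δ : ℝ) (μ : Measure Omega) : Prop :=
  ∃ ν : Measure Omega, IsProbabilityMeasure ν ∧ IsRuelleFixed (potential γ δ) ν ∧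
    μ = (∫⁻ x, eigenfunction γ δ x ∂ν)⁻¹ • ν.withDensity (eigenfunction γ δ)

/-- The cylinder `[0]`. -/
def cylZero : Set Omega := {x | x 0 = 0}

/-- The correlation `∫ (I_[0] ∘ σ^q) (I_[0] - μ[0]) dμ`. -/
noncomputable def correlation (μ : Measure Omega) (q : ℕ) : ℝ :=
  ∫ x, cylZero.indicator (fun _ => (1 : ℝ)) (shift^[q] x) *
    (cylZero.indicator (fun _ => (1 : ℝ)) x - μ.real cylZero) ∂μ

end DoubleHofbauer

/-! Under a fixed measure `ν` of the dual operator, a sequence is an alternating concatenation of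
independent blocks: a block of zeros has length `n + 1` with probability `(n + 1) ^ (-γ) / ζ(γ)`, a
block of ones likewise with `δ`, and each first symbol has probability `1/2`
(`measure_blockSet_inter`, `measure_cyl`). On a first block of length `n + 1` the eigenfunction is
tail over mass of the block law (`eigenfunction_eq`), so everything about `μ₁` becomes renewal
theory, and nothing depends on the choice of `ν`. Conversely, i.i.d. pairs of blocks produce such a
`ν`.

Write `F` for the generating function of a block length, `T` for that of its tail, and `m = T(1)`
for the mean length, so that `1 - F = (1 - X) T`. The renewal equations (`hit_eq`) involve `1 - F_γ
F_δ = (1 - X) D` with `D = T_γ + T_δ - (1 - X) T_γ T_δ`. Solving them shows that `μ₁(x₀ = x_q = 0)`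
is `(m_γ - ∑_{n < q} K_n) / (m_γ + m_δ)` with `K = T_γ T_δ / D`. The total of `K` is `m_γ m_δ / (m_γ
+ m_δ)`, exactly what cancels `μ₁[0] ^ 2`; the correlation is therefore the tail of `K` from `q` on,
divided by `m_γ + m_δ`.

It remains to find the asymptotics of `K_n`. The series `D` has no zero in the closed unit disc, so
Wiener's lemma puts the coefficients of `1 / D` in `ℓ¹`, and a bootstrap (`Decays.inv`) gives them
the decay `n ^ (1 - δ)` of the coefficients of `D`. Since `δ < γ`, only the tails of the blocks of
ones matter at this scale. The coefficient of `n ^ (1 - δ)` in `K_n` is positive, and summing the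
tail gives `q ^ (2 - δ)`. The hypothesis `2 < δ` makes the mean lengths finite and the exponent `δ -
1` summable. -/

namespace DoubleHofbauer

/-! ### Wiener's lemma for power series with summable coefficients -/

/-- The space `ℓ¹(ℕ, ℂ)`. -/
abbrev EllOne : Type := lp (fun _ : ℕ => ℂ) 1

theorem hasSum_norm_ellOne (x : EllOne) : HasSum (fun n => ‖x n‖) ‖x‖ := by
  simpa using lp.hasSum_norm (p := 1) (by simp) x

theorem memℓp_one_of_summable {x : ℕ → ℂ} (h : Summable fun n => ‖x n‖) :
    Memℓp (E := fun _ : ℕ => ℂ) x 1 := by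
  refine (memℓp_gen_iff (by simp)).2 ?_
  simpa using h

/-- The sequence `0 x₀ x₁ x₂ …`. -/
def consZero (x : ℕ → ℂ) : ℕ → ℂ
  | 0 => 0
  | n + 1 => x n

theorem memℓp_consZero (x : EllOne) : Memℓp (E := fun _ : ℕ => ℂ) (consZero x) 1 :=
  memℓp_one_of_summable ((summable_nat_add_iff 1).1 (hasSum_norm_ellOne x).summable)

/-- The right shift of `ℓ¹(ℕ, ℂ)`, as a linear map. -/
noncomputable def rightShiftLin : EllOne →ₗ[ℂ] EllOne where
  toFun x := ⟨consZero x, memℓp_consZero x⟩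
  map_add' x y := lp.ext <| funext fun n => by
    cases n with
    | zero => exact (add_zero (0 : ℂ)).symm
    | succ n => rfl
  map_smul' c x := lp.ext <| funext fun n => by
    cases n with
    | zero => exact (smul_zero c).symm
    | succ n => rfl

theorem norm_rightShiftLin (x : EllOne) : ‖rightShiftLin x‖ = ‖x‖ := by
  have h2 := (hasSum_nat_add_iff' 1).2 (hasSum_norm_ellOne (rightShiftLin x))
  have h3 := h2.unique (hasSum_norm_ellOne x)
  have h0 : rightShiftLin x 0 = 0 := rfl
  simpa [h0] using h3

/-- The right shift of `ℓ¹(ℕ, ℂ)`. -/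
noncomputable def rightShift : EllOne →L[ℂ] EllOne :=
  rightShiftLin.mkContinuous 1 fun x => by rw [norm_rightShiftLin, one_mul]

theorem rightShift_apply_zero (x : EllOne) : rightShift x 0 = 0 := rfl

theorem rightShift_apply_succ (x : EllOne) (n : ℕ) : rightShift x (n + 1) = x n := rfl

theorem norm_rightShift_le : ‖rightShift‖ ≤ 1 :=
  LinearMap.mkContinuous_norm_le _ zero_le_one _

theorem rightShift_pow_apply (x : EllOne) (k n : ℕ) :
    (rightShift ^ k) x n = if k ≤ n then x (n - k) else 0 := by
  induction k generalizing n with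
  | zero => simp
  | succ k ih =>
    rw [pow_succ', mul_apply_eq_comp]
    cases n with
    | zero => simp [rightShift_apply_zero]
    | succ n => rw [rightShift_apply_succ, ih]; simp

section Banach

variable {A : Type*} [NormedRing A] [NormedAlgebra ℂ A]

/-- Gelfand theory needs commutativity, which the operators on `ℓ¹` lack; the closed subalgebra
generated by one operator has it. -/
noncomputable instance (S : A) : NormedCommRing (Algebra.elemental ℂ S) :=
  { (inferInstance : NormedRing (Algebra.elemental ℂ S)) with
    mul_comm := (inferInstance : CommRing (Algebra.elemental ℂ S)).mul_comm }

/-- In a Banach algebra, a power series in a contraction with absolutely summable coefficients is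
right invertible if it does not vanish on the closed unit disc. -/
theorem exists_right_inv_tsum_smul_pow [CompleteSpace A] [NormOneClass A] {S : A} (hS : ‖S‖ ≤ 1)
    {a : ℕ → ℂ} (ha : Summable fun n => ‖a n‖)
    (hz : ∀ z : ℂ, ‖z‖ ≤ 1 → ∑' n, a n * z ^ n ≠ 0) :
    ∃ b c : A, HasSum (fun n => a n • S ^ n) b ∧ b * c = 1 := by
  let s : Algebra.elemental ℂ S := ⟨S, Algebra.elemental.self_mem ℂ _⟩
  have hs : ‖s‖ ≤ 1 := hS
  have hone : ‖(1 : Algebra.elemental ℂ S)‖ ≤ 1 := (norm_one : ‖(1 : A)‖ = 1).le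
  have hsum : Summable fun n => a n • s ^ n := by
    refine Summable.of_norm_bounded ha fun n => ?_
    rw [norm_smul]
    refine mul_le_of_le_one_right (norm_nonneg _) ?_
    rcases Nat.eq_zero_or_pos n with rfl | hn
    · rwa [pow_zero]
    · exact (norm_pow_le' s hn).trans (pow_le_one₀ (norm_nonneg _) hs)
  have hunit : IsUnit (∑' n, a n • s ^ n) := by
    -- A non-unit of a commutative complex Banach algebra is killed by a character `χ`. By
    -- continuity, `χ` maps the series to the value of the power series at `χ s`, a point of the
    -- closed disc.
    by_contra hnu
    obtain ⟨χ, hχ⟩ := WeakDual.CharacterSpace.exists_apply_eq_zero hnu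
    have hsp : ‖χ s‖ ≤ 1 := by
      have h1 := AlgHom.apply_mem_spectrum χ s
      have h2 := spectrum.norm_le_norm_mul_of_mem h1
      exact h2.trans (mul_le_one₀ hs (norm_nonneg _) hone)
    refine hz (χ s) hsp ?_
    rw [← hχ]
    have h3 := hsum.hasSum.map χ (map_continuous χ)
    rw [← h3.tsum_eq]
    simp
  obtain ⟨c, hc⟩ := hunit.exists_right_inv
  refine ⟨_, c, ?_, congrArg Subtype.val hc⟩
  exact hsum.hasSum.map (Algebra.elemental ℂ S).val continuous_subtype_val

end Banach

/-- **Wiener's lemma** on `ℓ¹(ℕ)`: if a power series with absolutely summable coefficients does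
not vanish on the closed unit disc, then its inverse has absolutely summable coefficients. -/
theorem summable_coeff_inv {a : PowerSeries ℝ} (ha : Summable fun n => ‖PowerSeries.coeff n a‖)
    (hz : ∀ z : ℂ, ‖z‖ ≤ 1 → ∑' n, ((PowerSeries.coeff n a : ℝ) : ℂ) * z ^ n ≠ 0) :
    Summable fun n => ‖PowerSeries.coeff n a⁻¹‖ := by
  -- Nontriviality gives the identity operator norm one.
  have : Nontrivial EllOne := ⟨lp.single 1 0 1, 0, fun h => by
    simpa using congrArg (fun x : EllOne => x 0) h⟩
  obtain ⟨b, c, hb, hc⟩ := exists_right_inv_tsum_smul_pow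
    (a := fun n => (PowerSeries.coeff n a : ℝ))
    norm_rightShift_le (by simpa using ha) hz
  -- The right shift is multiplication by `X`, so `b` is multiplication by `a`. Hence `y = c e₀` is
  -- an `ℓ¹` sequence with `a * y = 1`, and uniqueness of inverses identifies it with `a⁻¹`.
  set y : EllOne := c (lp.single 1 0 1) with hy
  have hby : b y = lp.single 1 0 1 := by
    have := congrArg (fun t : EllOne →L[ℂ] EllOne => t (lp.single 1 0 1)) hc
    simpa using this
  have hcoord : ∀ n, HasSum (fun k => ((PowerSeries.coeff k a : ℝ) : ℂ) *
      (if k ≤ n then y (n - k) else 0)) ((lp.single 1 0 1 : EllOne) n) := by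
    intro n
    have h3 := (lp.evalCLM ℂ (fun _ : ℕ => ℂ) 1 n).hasSum
      ((ContinuousLinearMap.apply ℂ EllOne y).hasSum hb)
    have h4 : (lp.evalCLM ℂ (fun _ : ℕ => ℂ) 1 n) ((ContinuousLinearMap.apply ℂ EllOne y) b)
      = (lp.single 1 0 1 : EllOne) n := by
      rw [← hby]; rfl
    rw [h4] at h3
    refine h3.congr_fun fun k => ?_
    rw [← rightShift_pow_apply]
    rfl
  have hmul : a.map Complex.ofRealHom * PowerSeries.mk (fun n => y n) = 1 := by
    ext n
    rw [PowerSeries.coeff_mul, Finset.Nat.sum_antidiagonal_eq_sum_range_succ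
      (fun i j => PowerSeries.coeff i (a.map Complex.ofRealHom) *
        PowerSeries.coeff j (PowerSeries.mk fun n => y n))]
    have h1 := hcoord n
    have h2 : HasSum (fun k => ((PowerSeries.coeff k a : ℝ) : ℂ) *
      (if k ≤ n then y (n - k) else 0)) (∑ k ∈ Finset.range n.succ, ((PowerSeries.coeff k a : ℝ) : ℂ) *
      (if k ≤ n then y (n - k) else 0)) := hasSum_sum_of_ne_finset_zero fun k hk => by
        rw [if_neg (by simpa [Nat.lt_succ_iff] using hk), mul_zero]
    have h3 := h1.unique h2
    rw [lp.single_apply] at h3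
    calc _ = ∑ k ∈ Finset.range n.succ, ((PowerSeries.coeff k a : ℝ) : ℂ) *
          (if k ≤ n then y (n - k) else 0) := Finset.sum_congr rfl fun k hk => by
          rw [if_pos (by simpa [Nat.lt_succ_iff] using hk)]
          simp
      _ = _ := by
          rw [← h3, PowerSeries.coeff_one]
          simp [Pi.single_apply]
  have ha0 : PowerSeries.constantCoeff a ≠ 0 := by
    intro h0
    have := congrArg PowerSeries.constantCoeff hmul
    rw [map_mul, ← PowerSeries.coeff_zero_eq_constantCoeff_apply, PowerSeries.coeff_map,
      PowerSeries.coeff_zero_eq_constantCoeff_apply, h0] at this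
    simp at this
  have hinv : a.map Complex.ofRealHom * a⁻¹.map Complex.ofRealHom = 1 := by
    rw [← map_mul, PowerSeries.mul_inv_cancel _ ha0, map_one]
  have heq : PowerSeries.mk (fun n => y n) = a⁻¹.map Complex.ofRealHom := by
    calc _ = (a.map Complex.ofRealHom * a⁻¹.map Complex.ofRealHom) *
          PowerSeries.mk (fun n => y n) := by rw [hinv, one_mul]
      _ = (a.map Complex.ofRealHom * PowerSeries.mk (fun n => y n)) *
          a⁻¹.map Complex.ofRealHom := by ring
      _ = _ := by rw [hmul, one_mul]
  have := (hasSum_norm_ellOne y).summable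
  refine this.congr fun n => ?_
  have h := congrArg (PowerSeries.coeff n) heq
  rw [PowerSeries.coeff_mk] at h
  rw [h]
  simp

/-! ### Power-law decay under convolution and inversion -/

/-- The weight `(n + 1) ^ (-s)`. -/
noncomputable def weight (s : ℝ) (n : ℕ) : ℝ := ((n : ℝ) + 1) ^ (-s)

theorem weight_pos (s : ℝ) (n : ℕ) : 0 < weight s n := by
  unfold weight; positivity

theorem summable_weight {s : ℝ} (hs : 1 < s) : Summable (weight s) := by
  have h := (summable_nat_add_iff 1).2 (Real.summable_nat_rpow.2 (neg_lt_neg hs))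
  refine h.congr fun n => ?_
  unfold weight
  push_cast
  rfl

theorem weight_le_of_le_two_mul {s : ℝ} (hs : 0 ≤ s) {n j : ℕ} (h : n ≤ 2 * j) :
    weight s j ≤ 2 ^ s * weight s n := by
  have h' : (n : ℝ) + 1 ≤ 2 * ((j : ℝ) + 1) := by
    have : (n : ℝ) ≤ 2 * j := by exact_mod_cast h
    linarith
  unfold weight
  rw [Real.rpow_neg (by positivity), Real.rpow_neg (by positivity), ← div_eq_mul_inv,
    inv_eq_one_div, div_le_div_iff₀ (by positivity) (by positivity), one_mul,
    ← Real.mul_rpow (by norm_num) (by positivity)]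
  exact Real.rpow_le_rpow (by positivity) h' hs

theorem weight_sub_one (s : ℝ) (n : ℕ) : weight (s - 1) n = ((n : ℝ) + 1) * weight s n := by
  unfold weight
  rw [show -(s - 1) = 1 + -s by ring, Real.rpow_add (by positivity), Real.rpow_one]

theorem tendsto_natCast_div_natCast_add_one :
    Tendsto (fun n : ℕ => (n : ℝ) / ((n : ℝ) + 1)) atTop (𝓝 1) :=
  tendsto_natCast_div_add_atTop 1

theorem tendsto_weight_succ_div (s : ℝ) :
    Tendsto (fun n => weight s n / weight s (n + 1)) atTop (𝓝 1) := by
  have h := (tendsto_add_atTop_iff_nat 1).2 tendsto_natCast_div_natCast_add_one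
  have h2 := h.rpow_const (p := -s) (Or.inl one_ne_zero)
  rw [Real.one_rpow] at h2
  refine h2.congr fun n => ?_
  unfold weight
  rw [Real.div_rpow (by positivity) (by positivity)]
  push_cast
  rfl

theorem tendsto_weight_div_weight_add (s : ℝ) (k : ℕ) :
    Tendsto (fun n => weight s n / weight s (n + k)) atTop (𝓝 1) := by
  induction k with
  | zero => exact tendsto_const_nhds.congr fun n =>
      (div_self (weight_pos s n).ne').symm
  | succ k ih =>
    have h := ih.mul ((tendsto_add_atTop_iff_nat k).2 (tendsto_weight_succ_div s))
    rw [one_mul] at h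
    refine h.congr fun n => ?_
    rw [div_mul_div_cancel₀ (weight_pos s _).ne', add_assoc]

/-- `a n` is asymptotic to `α (n + 1) ^ (-s)`, in the sense that the quotient of `a n` by
`(n + 1) ^ (-s)` tends to `α` (which may be `0`). -/
def Decays (s : ℝ) (a : ℕ → ℝ) (α : ℝ) : Prop :=
  Tendsto (fun n => a n / weight s n) atTop (𝓝 α)

theorem Decays.exists_bound {s α : ℝ} {a : ℕ → ℝ} (h : Decays s a α) :
    ∃ B, 0 ≤ B ∧ ∀ n, |a n| ≤ B * weight s n := by
  obtain ⟨B, hB⟩ := (Metric.isBounded_range_of_tendsto _ h).exists_norm_le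
  have hB' : ∀ n, |a n| ≤ B * weight s n := fun n => by
    have := hB _ ⟨n, rfl⟩
    rwa [Real.norm_eq_abs, abs_div, abs_of_pos (weight_pos s n), div_le_iff₀ (weight_pos s n)]
      at this
  exact ⟨B, (norm_nonneg _).trans (hB _ ⟨0, rfl⟩), hB'⟩

theorem Decays.summable {s α : ℝ} {a : ℕ → ℝ} (hs : 1 < s) (h : Decays s a α) :
    Summable fun n => ‖a n‖ := by
  obtain ⟨B, -, hB⟩ := h.exists_bound
  exact Summable.of_nonneg_of_le (fun n => norm_nonneg _) hB ((summable_weight hs).mul_left B)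

theorem Decays.add {s α β : ℝ} {a b : ℕ → ℝ} (ha : Decays s a α) (hb : Decays s b β) :
    Decays s (fun n => a n + b n) (α + β) :=
  (Tendsto.add ha hb).congr fun n => by rw [add_div]

theorem Decays.sub {s α β : ℝ} {a b : ℕ → ℝ} (ha : Decays s a α) (hb : Decays s b β) :
    Decays s (fun n => a n - b n) (α - β) :=
  (Tendsto.sub ha hb).congr fun n => by rw [sub_div]

theorem Decays.tendsto_sub {s α : ℝ} {a : ℕ → ℝ} (h : Decays s a α) (k : ℕ) :
    Tendsto (fun n => a (n - k) / weight s n) atTop (𝓝 α) := by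
  refine (tendsto_add_atTop_iff_nat k).1 ?_
  have h2 := Tendsto.mul h (tendsto_weight_div_weight_add s k)
  rw [mul_one] at h2
  refine h2.congr fun n => ?_
  rw [Nat.add_sub_cancel, div_mul_div_cancel₀ (weight_pos s _).ne']

/-- Half of a convolution: the terms in which the argument of the decaying sequence is large. -/
theorem tendsto_half_convolution {s β : ℝ} (hs : 0 ≤ s) {a b : ℕ → ℝ}
    (ha : Summable fun n => ‖a n‖) (hb : Decays s b β) {N : ℕ → ℕ} (hN : ∀ n, 2 * N n ≤ n + 2)
    (hN' : Tendsto N atTop atTop) :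
    Tendsto (fun n => (∑ k ∈ Finset.range (N n), a k * b (n - k)) / weight s n) atTop
      (𝓝 ((∑' k, a k) * β)) := by
  obtain ⟨B, hB0, hB⟩ := hb.exists_bound
  -- For `k < N n` the bound `hN` gives `n ≤ 2 * (n - k)`, so the weight at `n - k` is at most `2 ^
  -- s` times the weight at `n`; this is the domination.
  have key := tendsto_tsum_of_dominated_convergence (𝓕 := atTop)
    (f := fun n k => if k < N n then a k * (b (n - k) / weight s n) else 0)
    (g := fun k => a k * β) (bound := fun k => ‖a k‖ * (B * 2 ^ s)) (ha.mul_right _)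
    (fun k => by
      refine ((hb.tendsto_sub k).const_mul (a k)).congr' ?_
      filter_upwards [hN'.eventually_gt_atTop k] with n hn
      rw [if_pos hn])
    (Eventually.of_forall fun n k => by
      split_ifs with h
      · rw [norm_mul]
        refine mul_le_mul_of_nonneg_left ?_ (norm_nonneg _)
        rw [Real.norm_eq_abs, abs_div, abs_of_pos (weight_pos s n), div_le_iff₀ (weight_pos s n)]
        refine (hB _).trans ?_
        rw [mul_assoc]
        refine mul_le_mul_of_nonneg_left (weight_le_of_le_two_mul hs ?_) hB0
        have := hN n
        omega
      · rw [norm_zero]; positivity)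
  rw [tsum_mul_right] at key
  refine key.congr fun n => ?_
  rw [tsum_eq_sum (s := Finset.range (N n)) fun k hk => if_neg (by simpa using hk),
    Finset.sum_div]
  refine Finset.sum_congr rfl fun k hk => ?_
  rw [if_pos (by simpa using hk), mul_div_assoc]

/-- Cut in the middle, so that in each half one index is at least `n / 2` and the decay of that
factor can be used. The two lengths add up to `n + 1`. -/
theorem sum_antidiagonal_eq_halves (a b : ℕ → ℝ) (n : ℕ) :
    ∑ p ∈ Finset.HasAntidiagonal.antidiagonal n, a p.1 * b p.2 =
      ∑ k ∈ Finset.range (n / 2 + 1), a k * b (n - k) +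
        ∑ k ∈ Finset.range ((n + 1) / 2), b k * a (n - k) := by
  rw [Finset.Nat.sum_antidiagonal_eq_sum_range_succ (fun i j => a i * b j),
    show n.succ = (n / 2 + 1) + (n + 1) / 2 by omega, Finset.sum_range_add]
  congr 1
  rw [← Finset.sum_range_reflect]
  refine Finset.sum_congr rfl fun k hk => ?_
  rw [Finset.mem_range] at hk
  rw [mul_comm]
  congr 2 <;> omega

theorem two_mul_half_add_one_le (n : ℕ) : 2 * (n / 2 + 1) ≤ n + 2 := by omega

theorem two_mul_add_one_half_le (n : ℕ) : 2 * ((n + 1) / 2) ≤ n + 2 := by omega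

theorem tendsto_half_add_one : Tendsto (fun n : ℕ => n / 2 + 1) atTop atTop :=
  tendsto_atTop_mono (fun _ => Nat.le_succ _) (Nat.tendsto_div_const_atTop two_ne_zero)

theorem tendsto_add_one_half : Tendsto (fun n : ℕ => (n + 1) / 2) atTop atTop :=
  tendsto_atTop_mono (fun n => Nat.div_le_div_right (Nat.le_succ n))
    (Nat.tendsto_div_const_atTop two_ne_zero)

/-- The sequence of coefficients of a power series. -/
noncomputable abbrev cf (a : PowerSeries ℝ) (n : ℕ) : ℝ := PowerSeries.coeff n a

/-- The sum of the coefficients of a power series. -/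
noncomputable def total (a : PowerSeries ℝ) : ℝ := ∑' n, cf a n

theorem hasSum_cf {a : PowerSeries ℝ} (ha : Summable fun n => ‖cf a n‖) :
    HasSum (cf a) (total a) := ha.of_norm.hasSum

theorem summable_norm_cf_mul {a b : PowerSeries ℝ} (ha : Summable fun n => ‖cf a n‖)
    (hb : Summable fun n => ‖cf b n‖) : Summable fun n => ‖cf (a * b) n‖ := by
  simpa only [cf, PowerSeries.coeff_mul] using
    summable_norm_sum_mul_antidiagonal_of_summable_norm ha hb

theorem total_mul {a b : PowerSeries ℝ} (ha : Summable fun n => ‖cf a n‖)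
    (hb : Summable fun n => ‖cf b n‖) : total (a * b) = total a * total b := by
  simpa only [total, cf, PowerSeries.coeff_mul] using
    (tsum_mul_tsum_eq_tsum_sum_antidiagonal_of_summable_norm ha hb).symm

theorem total_one : total 1 = 1 := by
  unfold total
  rw [tsum_eq_single 0 fun n hn => by simp [cf, PowerSeries.coeff_one, hn]]
  simp [cf]

/-- One big jump: a large total index is reached by one large index, while the other factor
contributes its full sum. -/
theorem Decays.mul {s α β : ℝ} (hs : 1 < s) {a b : PowerSeries ℝ} (ha : Decays s (cf a) α)
    (hb : Decays s (cf b) β) : Decays s (cf (a * b)) (total a * β + total b * α) := by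
  have hs0 : 0 ≤ s := by linarith
  have h1 := tendsto_half_convolution hs0 (ha.summable hs) hb two_mul_half_add_one_le
    tendsto_half_add_one
  have h2 := tendsto_half_convolution hs0 (hb.summable hs) ha two_mul_add_one_half_le
    tendsto_add_one_half
  refine (h1.add h2).congr fun n => ?_
  rw [← add_div, ← sum_antidiagonal_eq_halves, cf, PowerSeries.coeff_mul]

theorem Decays.X_mul {s α : ℝ} {a : PowerSeries ℝ} (ha : Decays s (cf a) α) :
    Decays s (cf (PowerSeries.X * a)) α := by
  refine (ha.tendsto_sub 1).congr' ?_
  filter_upwards [eventually_ge_atTop 1] with n hn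
  obtain ⟨k, rfl⟩ := Nat.exists_eq_add_of_le' hn
  rw [cf, cf, PowerSeries.coeff_succ_X_mul, Nat.add_sub_cancel]

theorem coeff_X_mul_derivative (a : PowerSeries ℝ) (n : ℕ) :
    cf (PowerSeries.X * PowerSeries.derivative ℝ a) n = n * cf a n := by
  cases n with
  | zero => simp [cf]
  | succ n =>
    rw [cf, PowerSeries.coeff_succ_X_mul, PowerSeries.coeff_derivative]
    push_cast
    ring

/-- Compare coefficients in `X (1/d)' = -(1/d)² X d'`. The factor `n` on the left is what lets
summability of `1/d` be upgraded to pointwise decay. -/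
theorem natCast_mul_cf_inv (d : PowerSeries ℝ) (n : ℕ) :
    n * cf d⁻¹ n =
      -∑ p ∈ Finset.HasAntidiagonal.antidiagonal n, cf (d⁻¹ ^ 2) p.1 * (p.2 * cf d p.2) := by
  have h : PowerSeries.X * PowerSeries.derivative ℝ d⁻¹ =
      -(d⁻¹ ^ 2 * (PowerSeries.X * PowerSeries.derivative ℝ d)) := by
    rw [PowerSeries.derivative_inv']
    ring
  rw [← coeff_X_mul_derivative, h, cf, map_neg, PowerSeries.coeff_mul]
  simp only [← coeff_X_mul_derivative]

/-- At a first `n ≥ N` where `x n` exceeds a bound `L ≥ 2 * A` valid before, the choice `M = x n`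
gives `x n ≤ 2 * A`. The index `j = n` has to be allowed because the recursion for the inverse
involves its own `n`-th coefficient. -/
theorem exists_bound_of_self_bound {x : ℕ → ℝ} {A : ℝ} {N : ℕ}  (hx : ∀ n, 0 ≤ x n)
    (h : ∀ n ≥ N, ∀ M, (∀ j ≤ n, x j ≤ M) → x n ≤ A + M / 2) : ∃ L, 0 ≤ L ∧ ∀ n, x n ≤ L := by
  have hA : ∃ L, 0 ≤ L ∧ 2 * A ≤ L ∧ ∀ n < N, x n ≤ L := by
    have hs : 0 ≤ ∑ j ∈ Finset.range N, x j := Finset.sum_nonneg fun j _ => hx j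
    refine ⟨∑ j ∈ Finset.range N, x j + |2 * A|, by positivity, ?_, fun n hn => ?_⟩
    · linarith [le_abs_self (2 * A)]
    · have := Finset.single_le_sum (fun j _ => hx j) (Finset.mem_range.2 hn)
      linarith [abs_nonneg (2 * A)]
  obtain ⟨L, hL0, hLA, hL⟩ := hA
  refine ⟨L, hL0, fun n => ?_⟩
  induction n using Nat.strong_induction_on with
  | _ n ih =>
    by_contra! hlt
    rcases lt_or_ge n N with hn | hn
    · exact absurd (hL n hn) (not_le.2 hlt)
    · have := h n hn (x n) fun j hj => by
        rcases hj.lt_or_eq with hj | rfl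
        · exact (ih j hj).trans hlt.le
        · exact le_rfl
      linarith

/-- Bound for half of a convolution. -/
theorem abs_half_convolution_le {s : ℝ} (hs : 0 ≤ s) {a b : ℕ → ℝ} {N n : ℕ} {A B : ℝ}
    (hB0 : 0 ≤ B) (ha : ∑ k ∈ Finset.range N, |a k| ≤ A)
    (hb : ∀ j ≤ n, |b j| ≤ B * weight s j) (hN : 2 * N ≤ n + 2) :
    |∑ k ∈ Finset.range N, a k * b (n - k)| ≤ A * (B * (2 ^ s * weight s n)) := by
  have hw := weight_pos s n
  calc _ ≤ ∑ k ∈ Finset.range N, |a k| * (B * (2 ^ s * weight s n)) := by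
        refine (Finset.abs_sum_le_sum_abs _ _).trans (Finset.sum_le_sum fun k hk => ?_)
        rw [Finset.mem_range] at hk
        rw [abs_mul]
        refine mul_le_mul_of_nonneg_left ((hb _ (Nat.sub_le _ _)).trans ?_) (abs_nonneg _)
        exact mul_le_mul_of_nonneg_left (weight_le_of_le_two_mul hs (by omega)) hB0
    _ ≤ _ := by
        rw [← Finset.sum_mul]
        exact mul_le_mul_of_nonneg_right ha (by positivity)

section Inverse

variable {s δ : ℝ} {d : PowerSeries ℝ}

theorem Decays.natCast_mul {a : ℕ → ℝ} {α : ℝ} (ha : Decays s a α) :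
    Decays (s - 1) (fun n => n * a n) α := by
  have h := tendsto_natCast_div_natCast_add_one.mul ha
  rw [one_mul] at h
  refine h.congr fun n => ?_
  rw [weight_sub_one, div_mul_div_comm]

theorem tendsto_weight_zero (hs : 0 < s) : Tendsto (weight s) atTop (𝓝 0) := by
  refine (tendsto_rpow_neg_atTop hs).comp ?_
  exact tendsto_atTop_add_const_right _ _ tendsto_natCast_atTop_atTop

theorem Decays.tendsto_zero (hs : 0 < s) {a : ℕ → ℝ} {α : ℝ} (ha : Decays s a α) :
    Tendsto a atTop (𝓝 0) := by
  have h := Tendsto.mul ha (tendsto_weight_zero hs)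
  rw [mul_zero] at h
  exact h.congr fun n => div_mul_cancel₀ _ (weight_pos s n).ne'

theorem Decays.tendsto_cesaro (hs : 1 < s) {a : ℕ → ℝ} {α : ℝ} (ha : Decays s a α) :
    Tendsto (fun n : ℕ => (∑ k ∈ Finset.range n, |k * a k|) / n) atTop (𝓝 0) := by
  have h := (ha.natCast_mul.tendsto_zero (by linarith)).abs.cesaro
  rw [abs_zero] at h
  exact h.congr fun n => by rw [div_eq_inv_mul]

theorem sum_half_le (v : ℕ → ℝ) (n : ℕ) :
    ∑ k ∈ Finset.range ((n + 1) / 2), |v k| ≤ ∑ k ∈ Finset.range n, |v k| :=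
  Finset.sum_le_sum_of_subset_of_nonneg (Finset.range_mono (by omega)) fun _ _ _ => abs_nonneg _

theorem sum_range_le_tsum {a : ℕ → ℝ} (ha : Summable fun n => ‖a n‖) (n : ℕ) :
    ∑ k ∈ Finset.range n, |a k| ≤ ∑' k, ‖a k‖ :=
  ha.sum_le_tsum _ fun k _ => norm_nonneg (a k)

/-- If the coefficients of a power series are bounded by the weight up to `n`, then so are those
of its square. -/
theorem abs_cf_sq_le {e : PowerSeries ℝ} (hs : 0 ≤ s) (he : Summable fun n => ‖cf e n‖)
    {M : ℝ} (hM0 : 0 ≤ M) {n : ℕ} (hM : ∀ j ≤ n, |cf e j| ≤ M * weight s j) {j : ℕ} (hj : j ≤ n) :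
    |cf (e ^ 2) j| ≤ (2 * (∑' k, ‖cf e k‖) * 2 ^ s * M) * weight s j := by
  rw [pow_two, cf, PowerSeries.coeff_mul, sum_antidiagonal_eq_halves (cf e) (cf e)]
  have h1 := abs_half_convolution_le hs hM0 (sum_range_le_tsum he _)
    (fun _ hi => hM _ (hi.trans hj)) (two_mul_half_add_one_le j)
  have h2 := abs_half_convolution_le hs hM0 (sum_range_le_tsum he _)
    (fun i hi => hM i (hi.trans hj)) (two_mul_add_one_half_le j)
  refine (abs_add_le _ _).trans ((add_le_add h1 h2).trans_eq ?_)
  ring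

/-- Bootstrap on the recursion for `n * cf d⁻¹ n`. The half with a large index on `d` is controlled
by the given data. The half with a large index on `d⁻¹ ^ 2` costs the unknown bound `M` times a
Cesàro mean of `k * |cf d k|`, which tends to `0`, so eventually at most `M / 2`. -/
theorem exists_bound_cf_inv (hs : 1 < s) (hd : Decays s (cf d) δ)
    (he : Summable fun n => ‖cf d⁻¹ n‖) : ∃ L, 0 ≤ L ∧ ∀ n, |cf d⁻¹ n| ≤ L * weight s n := by
  have hs0 : 0 ≤ s := by linarith
  have hg : Summable fun n => ‖cf (d⁻¹ ^ 2) n‖ := by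
    rw [pow_two]; exact summable_norm_cf_mul he he
  obtain ⟨B, hB0, hB⟩ := hd.exists_bound
  set S := ∑' k, ‖cf d⁻¹ k‖
  set G := ∑' k, ‖cf (d⁻¹ ^ 2) k‖
  have hS0 : 0 ≤ S := tsum_nonneg fun _ => norm_nonneg _
  have hG0 : 0 ≤ G := tsum_nonneg fun _ => norm_nonneg _
  set c : ℝ := 2 ^ s
  have hc0 : 0 < c := by positivity
  -- One factor `c = 2 ^ s` comes from squaring the inverse, the other from the half convolution.
  have hces : ∀ᶠ n : ℕ in atTop,
      (∑ k ∈ Finset.range n, |k * cf d k|) / n * (2 * S * c * c) < 1 / 2 := by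
    have h := (hd.tendsto_cesaro hs).mul_const (2 * S * c * c)
    rw [zero_mul] at h
    exact h.eventually_lt_const (by norm_num)
  obtain ⟨N, hN⟩ := eventually_atTop.1 hces
  obtain ⟨L, hL0, hL⟩ := exists_bound_of_self_bound (x := fun n => |cf d⁻¹ n| / weight s n)
    (A := G * (B * c)) (N := N + 1)
    (fun n => div_nonneg (abs_nonneg _) (weight_pos s n).le) (fun n hn M hM => by
      have hn0 : 0 < (n : ℝ) := by exact_mod_cast (Nat.succ_pos N).trans_le hn
      have hM' : ∀ j ≤ n, |cf d⁻¹ j| ≤ M * weight s j := fun j hj =>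
        (div_le_iff₀ (weight_pos s j)).1 (hM j hj)
      have hM0 : 0 ≤ M :=
        le_trans (div_nonneg (abs_nonneg _) (weight_pos s 0).le) (hM 0 (Nat.zero_le n))
      have hw := weight_pos s n
      have h1 : |∑ k ∈ Finset.range (n / 2 + 1), cf (d⁻¹ ^ 2) k * (((n - k : ℕ) : ℝ) *
          cf d (n - k))| ≤ G * (n * B * (c * weight s n)) := by
        refine abs_half_convolution_le (b := fun j => (j : ℝ) * cf d j) hs0 (by positivity)
          (sum_range_le_tsum hg _) (fun j hj => ?_) (two_mul_half_add_one_le n)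
        rw [abs_mul, Nat.abs_cast, mul_assoc]
        have : (j : ℝ) ≤ n := by exact_mod_cast hj
        exact mul_le_mul this (hB j) (abs_nonneg _) hn0.le
      have h2 := abs_half_convolution_le (a := fun k => (k : ℝ) * cf d k) hs0
        (B := 2 * S * c * M) (by positivity) (sum_half_le (fun k => (k : ℝ) * cf d k) n)
        (fun j hj => abs_cf_sq_le hs0 he hM0 hM' hj) (two_mul_add_one_half_le n)
      have h3 := natCast_mul_cf_inv d n
      rw [sum_antidiagonal_eq_halves (cf (d⁻¹ ^ 2)) (fun k => (k : ℝ) * cf d k)] at h3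
      have h4 : n * |cf d⁻¹ n| ≤ G * (n * B * (c * weight s n)) +
          (∑ k ∈ Finset.range n, |k * cf d k|) * (2 * S * c * M * (c * weight s n)) := by
        rw [show (n : ℝ) * |cf d⁻¹ n| = |n * cf d⁻¹ n| by rw [abs_mul, Nat.abs_cast], h3, abs_neg]
        exact (abs_add_le _ _).trans (add_le_add h1 h2)
      have h5 := hN n ((Nat.le_succ N).trans hn)
      rw [div_le_iff₀ hw]
      have h6 : (∑ k ∈ Finset.range n, |k * cf d k|) * (2 * S * c * c) ≤ n / 2 := by
        have := mul_le_mul_of_nonneg_right h5.le hn0.le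
        rw [div_mul_eq_mul_div, div_mul_cancel₀ _ hn0.ne'] at this
        linarith
      have h7 := mul_le_mul_of_nonneg_right h6 (mul_nonneg hM0 hw.le)
      refine le_of_mul_le_mul_left ?_ hn0
      nlinarith [h4, h7])
  exact ⟨L, hL0, fun n => (div_le_iff₀ (weight_pos s n)).1 (hL n)⟩

/-- The coefficients of the inverse of a power series decay as fast as those of the series. -/
theorem Decays.inv (hs : 1 < s) (hd : Decays s (cf d) δ) (he : Summable fun n => ‖cf d⁻¹ n‖) :
    Decays s (cf d⁻¹) (-(total d⁻¹ ^ 2 * δ)) := by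
  have hs0 : 0 ≤ s := by linarith
  have hg : Summable fun n => ‖cf (d⁻¹ ^ 2) n‖ := by
    rw [pow_two]; exact summable_norm_cf_mul he he
  obtain ⟨L, hL0, hL⟩ := exists_bound_cf_inv hs hd he
  -- This half of the recursion carries the limit, with exponent `s - 1` because of the factor `n`;
  -- `h2` shows that the other half is negligible, again by Cesàro means.
  have h1 := tendsto_half_convolution (by linarith : 0 ≤ s - 1) hg hd.natCast_mul
    two_mul_half_add_one_le tendsto_half_add_one
  have hgt : ∑' k, cf (d⁻¹ ^ 2) k = total d⁻¹ ^ 2 := by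
    rw [pow_two, pow_two, ← total_mul he he]; rfl
  rw [hgt] at h1
  set B := 2 * (∑' k, ‖cf d⁻¹ k‖) * 2 ^ s * L with hBdef
  have hS0 : 0 ≤ ∑' k, ‖cf d⁻¹ k‖ := tsum_nonneg fun _ => norm_nonneg _
  have hB0 : 0 ≤ B := by positivity
  have h2 : Tendsto (fun n => (∑ k ∈ Finset.range ((n + 1) / 2), (k * cf d k) *
      cf (d⁻¹ ^ 2) (n - k)) / weight (s - 1) n) atTop (𝓝 0) := by
    have hc := (hd.tendsto_cesaro hs).mul_const (B * 2 ^ s)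
    rw [zero_mul] at hc
    refine squeeze_zero_norm' ?_ hc
    filter_upwards [eventually_gt_atTop 0] with n hn
    have hn0 : 0 < (n : ℝ) := by exact_mod_cast hn
    have hw := weight_pos s n
    have h := abs_half_convolution_le (a := fun k => (k : ℝ) * cf d k) hs0
        hB0 (sum_half_le (fun k => (k : ℝ) * cf d k) n)
        (fun j hj => abs_cf_sq_le hs0 he hL0 (fun j _ => hL j) hj) (two_mul_add_one_half_le n)
    rw [Real.norm_eq_abs, abs_div, abs_of_pos (weight_pos _ n), div_le_iff₀ (weight_pos _ n),
      weight_sub_one]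
    refine h.trans ?_
    have hx : 0 ≤ ∑ k ∈ Finset.range n, |(k : ℝ) * cf d k| :=
      Finset.sum_nonneg fun _ _ => abs_nonneg _
    calc _ = (∑ k ∈ Finset.range n, |(k : ℝ) * cf d k|) / n * (B * 2 ^ s) * (n * weight s n) := by
          field_simp
      _ ≤ _ := by
          refine mul_le_mul_of_nonneg_left ?_ (by positivity)
          exact mul_le_mul_of_nonneg_right (by linarith) hw.le
  have h3 := ((h1.add h2).neg.div tendsto_natCast_div_natCast_add_one one_ne_zero)
  rw [add_zero, div_one] at h3
  refine h3.congr' ?_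
  filter_upwards [eventually_gt_atTop 0] with n hn
  have hn0 : 0 < (n : ℝ) := by exact_mod_cast hn
  have hw := weight_pos s n
  rw [Pi.div_apply, ← add_div,
    ← sum_antidiagonal_eq_halves (cf (d⁻¹ ^ 2)) (fun k => (k : ℝ) * cf d k),
    ← neg_div, ← natCast_mul_cf_inv, weight_sub_one]
  field_simp

end Inverse

/-! ### Asymptotics of tails of series -/

/-- This is the derivative of `x ^ (-(s - 1))` at `1`, taken along increments `1 / (n + 1)`. The
differences serve as a comparison sequence because their tails telescope exactly. -/
theorem tendsto_weight_sub_weight (s : ℝ) :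
    Decays s (fun n => weight (s - 1) n - weight (s - 1) (n + 1)) (s - 1) := by
  have hder : HasDerivAt (fun x : ℝ => x ^ (-(s - 1))) (-(s - 1)) 1 := by
    simpa using Real.hasDerivAt_rpow_const (x := 1) (p := -(s - 1)) (Or.inl one_ne_zero)
  have hslope := hder.tendsto_slope_zero_right
  have hu : Tendsto (fun n : ℕ => 1 / ((n : ℝ) + 1)) atTop (𝓝[>] 0) :=
    tendsto_nhdsWithin_iff.2 ⟨tendsto_one_div_add_atTop_nhds_zero_nat,
      Eventually.of_forall fun n => by simp only [Set.mem_Ioi]; positivity⟩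
  have h := (hslope.comp hu).neg
  rw [neg_neg] at h
  refine h.congr fun n => ?_
  have hn : (0 : ℝ) < (n : ℝ) + 1 := by positivity
  have hw := weight_pos s n
  have h1 : weight (s - 1) (n + 1) = weight (s - 1) n * (1 + 1 / ((n : ℝ) + 1)) ^ (-(s - 1)) := by
    unfold weight
    rw [← Real.mul_rpow hn.le (by positivity)]
    congr 1
    push_cast
    field_simp
  simp only [h1, weight_sub_one, Function.comp, smul_eq_mul, Real.one_rpow, one_div, inv_inv]
  field_simp
  ring

theorem hasSum_weight_sub {s : ℝ} (hs : 1 < s) (n : ℕ) :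
    HasSum (fun j => weight (s - 1) (n + j) - weight (s - 1) (n + j + 1)) (weight (s - 1) n) := by
  refine (hasSum_iff_tendsto_nat_of_nonneg (fun j => ?_) _).2 ?_
  · rw [sub_nonneg]
    unfold weight
    refine Real.rpow_le_rpow_of_nonpos (by positivity) ?_ (by linarith)
    push_cast; linarith
  · have h := (tendsto_add_atTop_iff_nat n).2 (tendsto_weight_zero (s := s - 1) (by linarith))
    have h2 := h.const_sub (weight (s - 1) n)
    rw [sub_zero] at h2
    refine h2.congr fun k => ?_
    rw [add_comm k n]
    exact (Finset.sum_range_sub' (fun j => weight (s - 1) (n + j)) k).symm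

/-- Tails of a series whose terms decay like `(n + 1) ^ (-s)`. -/
theorem Decays.tail {s α : ℝ} (hs : 1 < s) {a : ℕ → ℝ} (ha : Decays s a α) :
    Decays (s - 1) (fun n => ∑' j, a (n + j)) (α / (s - 1)) := by
  have hs1 : 0 < s - 1 := by linarith
  set b : ℕ → ℝ := fun n => weight (s - 1) n - weight (s - 1) (n + 1)
  have hb : Decays s b (s - 1) := tendsto_weight_sub_weight s
  have hab : Tendsto (fun n => a n / b n) atTop (𝓝 (α / (s - 1))) :=
    (Tendsto.div ha hb hs1.ne').congr fun n => by
      rw [Pi.div_apply, div_div_div_cancel_right₀ (weight_pos s n).ne']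
  have hbpos : ∀ᶠ n in atTop, 0 < b n := by
    filter_upwards [Filter.Tendsto.eventually_const_lt hs1 hb] with n hn
    exact (div_pos_iff_of_pos_right (weight_pos s n)).1 hn
  have hasum : Summable a := (ha.summable hs).of_norm
  refine Metric.tendsto_atTop.2 fun ε hε => ?_
  have hev := (Metric.tendsto_atTop.1 hab (ε / 2) (by linarith))
  obtain ⟨N, hN⟩ := hev
  obtain ⟨N', hN'⟩ := eventually_atTop.1 hbpos
  refine ⟨max N N', fun n hn => ?_⟩
  have hsum := hasSum_weight_sub hs n
  have h1 : ∀ j, ‖a (n + j) - α / (s - 1) * b (n + j)‖ ≤ ε / 2 * b (n + j) := fun j => by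
    have hp := hN' (n + j) (by omega)
    have h := (hN (n + j) (by omega)).le
    rw [Real.dist_eq] at h
    calc _ = |(a (n + j) / b (n + j) - α / (s - 1)) * b (n + j)| := by
          rw [sub_mul, div_mul_cancel₀ _ hp.ne']; rfl
      _ = |a (n + j) / b (n + j) - α / (s - 1)| * b (n + j) := by rw [abs_mul, abs_of_pos hp]
      _ ≤ _ := mul_le_mul_of_nonneg_right h hp.le
  have hsa : Summable fun j => a (n + j) := by
    simpa only [add_comm] using (summable_nat_add_iff n).2 hasum
  have h2 := tsum_of_norm_bounded (hsum.mul_left (ε / 2)) h1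
  have h3 : ∑' j, (a (n + j) - α / (s - 1) * b (n + j)) =
      ∑' j, a (n + j) - α / (s - 1) * weight (s - 1) n := by
    rw [hsa.tsum_sub (hsum.summable.mul_left _), tsum_mul_left]
    exact congrArg (fun t => _ - _ * t) hsum.tsum_eq
  rw [h3, Real.norm_eq_abs] at h2
  have hw := weight_pos (s - 1) n
  rw [Real.dist_eq]
  calc _ = |(∑' j, a (n + j) - α / (s - 1) * weight (s - 1) n)| / weight (s - 1) n := by
        rw [← abs_of_pos hw, ← abs_div, abs_of_pos hw, sub_div, mul_div_cancel_right₀ _ hw.ne']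
    _ ≤ ε / 2 := (div_le_iff₀ hw).2 h2
    _ < ε := by linarith

/-! ### Sums of coefficients and values on the closed unit disc -/

theorem total_add {a b : PowerSeries ℝ} (ha : Summable fun n => ‖cf a n‖)
    (hb : Summable fun n => ‖cf b n‖) : total (a + b) = total a + total b := by
  simp only [total, cf, map_add]
  exact ha.of_norm.tsum_add hb.of_norm

theorem total_sub {a b : PowerSeries ℝ} (ha : Summable fun n => ‖cf a n‖)
    (hb : Summable fun n => ‖cf b n‖) : total (a - b) = total a - total b := by
  simp only [total, cf, map_sub]
  exact ha.of_norm.tsum_sub hb.of_norm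

theorem summable_norm_cf_X : Summable fun n => ‖cf PowerSeries.X n‖ :=
  summable_of_ne_finset_zero (s := {1}) fun n hn => by
    rw [cf, PowerSeries.coeff_X, if_neg (by simpa using hn), norm_zero]

theorem summable_norm_cf_one : Summable fun n => ‖cf 1 n‖ :=
  summable_of_ne_finset_zero (s := {0}) fun n hn => by
    rw [cf, PowerSeries.coeff_one, if_neg (by simpa using hn), norm_zero]

theorem total_X : total PowerSeries.X = 1 := by
  unfold total
  rw [tsum_eq_single 1 fun n hn => by simp [cf, PowerSeries.coeff_X, hn]]
  simp [cf]

/-- The value of a power series at a complex number. -/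
noncomputable def valueAt (z : ℂ) (a : PowerSeries ℝ) : ℂ := ∑' n, ((cf a n : ℝ) : ℂ) * z ^ n

section ValueAt

variable {z : ℂ} {a b : PowerSeries ℝ}

theorem norm_cf_mul_pow_le (hz : ‖z‖ ≤ 1) (n : ℕ) : ‖((cf a n : ℝ) : ℂ) * z ^ n‖ ≤ ‖cf a n‖ := by
  rw [norm_mul, Complex.norm_real, norm_pow]
  exact mul_le_of_le_one_right (norm_nonneg _) (pow_le_one₀ (norm_nonneg _) hz)

theorem summable_norm_cf_mul_pow (hz : ‖z‖ ≤ 1) (ha : Summable fun n => ‖cf a n‖) :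
    Summable fun n => ‖((cf a n : ℝ) : ℂ) * z ^ n‖ :=
  Summable.of_nonneg_of_le (fun _ => norm_nonneg _) (norm_cf_mul_pow_le hz) ha

theorem valueAt_sub (hz : ‖z‖ ≤ 1) (ha : Summable fun n => ‖cf a n‖)
    (hb : Summable fun n => ‖cf b n‖) : valueAt z (a - b) = valueAt z a - valueAt z b := by
  simp only [valueAt, cf, map_sub, Complex.ofReal_sub, sub_mul]
  exact (summable_norm_cf_mul_pow hz ha).of_norm.tsum_sub
    (summable_norm_cf_mul_pow hz hb).of_norm

theorem valueAt_mul (hz : ‖z‖ ≤ 1) (ha : Summable fun n => ‖cf a n‖)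
    (hb : Summable fun n => ‖cf b n‖) : valueAt z (a * b) = valueAt z a * valueAt z b := by
  unfold valueAt
  rw [tsum_mul_tsum_eq_tsum_sum_antidiagonal_of_summable_norm (summable_norm_cf_mul_pow hz ha)
    (summable_norm_cf_mul_pow hz hb)]
  refine tsum_congr fun n => ?_
  rw [cf, PowerSeries.coeff_mul, Complex.ofReal_sum, Finset.sum_mul]
  refine Finset.sum_congr rfl fun p hp => ?_
  rw [← Finset.HasAntidiagonal.mem_antidiagonal.1 hp, pow_add, Complex.ofReal_mul]
  ring

theorem valueAt_X : valueAt z PowerSeries.X = z := by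
  unfold valueAt
  rw [tsum_eq_single 1 fun n hn => by simp [cf, PowerSeries.coeff_X, hn]]
  simp [cf]

theorem valueAt_one : valueAt z 1 = 1 := by
  unfold valueAt
  rw [tsum_eq_single 0 fun n hn => by simp [cf, PowerSeries.coeff_one, hn]]
  simp [cf]

theorem valueAt_one_left (a : PowerSeries ℝ) : valueAt 1 a = total a := by
  simp only [valueAt, one_pow, mul_one, total, Complex.ofReal_tsum]

/-- A power series with nonnegative coefficients of sum `1`, the first two of which are positive,
has modulus less than `1` in the closed unit disc except at `1`. -/
theorem norm_valueAt_lt_one (hz : ‖z‖ ≤ 1) (hz1 : z ≠ 1) (ha : HasSum (cf a) 1)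
    (ha0 : ∀ n, 0 < cf a n) : ‖valueAt z a‖ < 1 := by
  have hsum : Summable fun n => ‖cf a n‖ := ha.summable.norm
  have hs := summable_norm_cf_mul_pow hz hsum
  -- Two terms suffice for strictness: `a₀ + a₁ z` has modulus less than `a₀ + a₁` because the real
  -- part of `z` is less than `1`. The remaining terms are bounded by the triangle inequality.
  have h1 : valueAt z a = ((cf a 0 : ℝ) + (cf a 1 : ℝ) * z) +
      ∑' n, ((cf a (n + 2) : ℝ) : ℂ) * z ^ (n + 2) := by
    rw [valueAt, ← hs.of_norm.sum_add_tsum_nat_add 2]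
    simp [Finset.sum_range_succ]
  have h2 := (hasSum_nat_add_iff' 2).2 ha
  have h3 := tsum_of_norm_bounded (f := fun n => ((cf a (n + 2) : ℝ) : ℂ) * z ^ (n + 2)) h2
    fun n => by
    refine (norm_cf_mul_pow_le hz (n + 2)).trans_eq ?_
    rw [Real.norm_of_nonneg (ha0 _).le]
  have hre : z.re < 1 := by
    by_contra! hge
    have h4 := (Complex.sq_norm z).symm.trans_le (pow_le_one₀ (norm_nonneg _) hz)
    rw [Complex.normSq_apply] at h4
    refine hz1 (Complex.ext ?_ ?_)
    · rw [Complex.one_re]; nlinarith [mul_self_nonneg z.im]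
    · rw [Complex.one_im]; nlinarith [mul_self_nonneg z.im]
  have h5 : ‖((cf a 0 : ℝ) + (cf a 1 : ℝ) * z : ℂ)‖ < cf a 0 + cf a 1 := by
    refine lt_of_pow_lt_pow_left₀ 2 (add_pos (ha0 0) (ha0 1)).le ?_
    have h4 := (Complex.sq_norm z).symm.trans_le (pow_le_one₀ (norm_nonneg _) hz)
    rw [Complex.normSq_apply] at h4
    rw [Complex.sq_norm, Complex.normSq_apply]
    simp only [Complex.add_re, Complex.add_im, Complex.ofReal_re, Complex.ofReal_im,
      Complex.re_ofReal_mul, Complex.im_ofReal_mul, zero_add]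
    have h01 := mul_pos (ha0 0) (ha0 1)
    have h11 := mul_pos (ha0 1) (ha0 1)
    nlinarith [mul_le_mul_of_nonneg_left h4 h11.le, mul_lt_mul_of_pos_left hre h01]
  have h6 : ∑ i ∈ Finset.range 2, cf a i = cf a 0 + cf a 1 := by
    simp [Finset.sum_range_succ]
  rw [h6] at h3
  rw [h1]
  exact (norm_add_le _ _).trans_lt (by linarith)

end ValueAt

/-! ### The law of a block length and its tail -/

/-- The probability `(n + 1) ^ (-s) / ζ(s)` that a block has length `n + 1`. -/
noncomputable def blockProb (s : ℝ) (n : ℕ) : ℝ := weight s n / zeta s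

/-- The probability that a block has length greater than `n`. -/
noncomputable def blockTail (s : ℝ) (n : ℕ) : ℝ := (∑' j, weight s (n + j)) / zeta s

/-- The generating function of the length of a block. -/
noncomputable def blockSeries (s : ℝ) : PowerSeries ℝ :=
  PowerSeries.X * PowerSeries.mk (blockProb s)

/-- The generating function of the tail of the length of a block. -/
noncomputable def tailSeries (s : ℝ) : PowerSeries ℝ := PowerSeries.mk (blockTail s)

/-- The mean length of a block. -/
noncomputable def meanBlock (s : ℝ) : ℝ := total (tailSeries s)

section Block

variable {s : ℝ}

theorem zeta_eq (s : ℝ) : zeta s = ∑' n, weight s n := by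
  refine tsum_congr fun n => ?_
  rw [weight, Real.rpow_neg (by positivity), one_div]

theorem zeta_pos (hs : 1 < s) : 0 < zeta s := by
  rw [zeta_eq]
  exact (summable_weight hs).tsum_pos (fun n => (weight_pos s n).le) 0 (weight_pos s 0)

theorem blockProb_pos (hs : 1 < s) (n : ℕ) : 0 < blockProb s n :=
  div_pos (weight_pos s n) (zeta_pos hs)

theorem hasSum_blockProb (hs : 1 < s) : HasSum (blockProb s) 1 := by
  have h := (summable_weight hs).hasSum.div_const (zeta s)
  rwa [← zeta_eq, div_self (zeta_pos hs).ne'] at h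

theorem blockTail_zero (hs : 1 < s) : blockTail s 0 = 1 := by
  simp only [blockTail, zero_add]
  rw [← zeta_eq, div_self (zeta_pos hs).ne']

theorem summable_weight_add (hs : 1 < s) (n : ℕ) : Summable fun j => weight s (n + j) := by
  simpa only [add_comm] using (summable_nat_add_iff n).2 (summable_weight hs)

theorem blockTail_eq (hs : 1 < s) (n : ℕ) :
    blockTail s n = blockProb s n + blockTail s (n + 1) := by
  unfold blockTail blockProb
  rw [(summable_weight_add hs n).tsum_eq_zero_add, add_div]
  simp only [add_zero, add_assoc, add_comm 1]

theorem blockTail_nonneg (hs : 1 < s) (n : ℕ) : 0 ≤ blockTail s n :=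
  div_nonneg (tsum_nonneg fun _ => (weight_pos s _).le) (zeta_pos hs).le

/-- Each mass is the difference of two successive tails, and the tail at `0` is `1`. This form
exhibits the zero of `1 - F` at `1`. -/
theorem blockSeries_eq (hs : 1 < s) :
    blockSeries s = 1 - (1 - PowerSeries.X) * tailSeries s := by
  ext n
  rw [sub_mul, one_mul, map_sub, map_sub]
  cases n with
  | zero => simp [blockSeries, tailSeries, blockTail_zero hs]
  | succ n =>
    rw [blockSeries, PowerSeries.coeff_succ_X_mul, PowerSeries.coeff_succ_X_mul,
      PowerSeries.coeff_one, if_neg n.succ_ne_zero]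
    simp only [tailSeries, PowerSeries.coeff_mk]
    linarith [blockTail_eq hs n]

theorem decays_weight (s : ℝ) : Decays s (weight s) 1 :=
  tendsto_const_nhds.congr fun n => (div_self (weight_pos s n).ne').symm

theorem decays_blockTail (hs : 1 < s) : Decays (s - 1) (blockTail s) (1 / (s - 1) / zeta s) :=
  ((decays_weight s).tail hs).div_const (zeta s) |>.congr fun n => by
    rw [blockTail, div_right_comm]

/-- This is why the smaller exponent `δ` decides: at its scale the tails with exponent `γ` have rate
`0`. -/
theorem Decays.zero_of_lt {s t α : ℝ} (hst : s < t) {a : ℕ → ℝ} (ha : Decays t a α) :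
    Decays s a 0 := by
  have h := Tendsto.mul ha (tendsto_weight_zero (sub_pos.2 hst))
  rw [mul_zero] at h
  refine h.congr fun n => ?_
  have h1 : weight t n = weight (t - s) n * weight s n := by
    unfold weight
    rw [← Real.rpow_add (by positivity)]
    congr 1
    ring
  rw [h1]
  have h2 := (weight_pos (t - s) n).ne'
  have h3 := (weight_pos s n).ne'
  field_simp

theorem cf_tailSeries (s : ℝ) : cf (tailSeries s) = blockTail s :=
  funext fun n => PowerSeries.coeff_mk n _

theorem summable_blockTail (hs : 2 < s) : Summable (blockTail s) :=
  ((decays_blockTail (by linarith)).summable (by linarith)).of_norm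

theorem summable_norm_tailSeries (hs : 2 < s) : Summable fun n => ‖cf (tailSeries s) n‖ := by
  rw [cf_tailSeries]
  exact (summable_blockTail hs).norm

theorem hasSum_blockTail (hs : 2 < s) : HasSum (blockTail s) (meanBlock s) := by
  have h := hasSum_cf (summable_norm_tailSeries hs)
  rwa [cf_tailSeries] at h

theorem meanBlock_pos (hs : 2 < s) : 0 < meanBlock s := by
  rw [← (hasSum_blockTail hs).tsum_eq]
  refine (summable_blockTail hs).tsum_pos (fun n => blockTail_nonneg (by linarith) n) 0 ?_
  rw [blockTail_zero (by linarith)]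
  exact one_pos

/-- Aperiodicity: lengths one and two both have positive probability. The factor `X` is removed
first so that these are the two leading coefficients. -/
theorem norm_valueAt_blockSeries_lt_one (hs : 1 < s) {z : ℂ} (hz : ‖z‖ ≤ 1) (hz1 : z ≠ 1) :
    ‖valueAt z (blockSeries s)‖ < 1 := by
  have hcf : cf (PowerSeries.mk (blockProb s)) = blockProb s :=
    funext fun n => PowerSeries.coeff_mk n _
  have hsum : HasSum (cf (PowerSeries.mk (blockProb s))) 1 := by
    rw [hcf]; exact hasSum_blockProb hs
  rw [blockSeries, valueAt_mul hz summable_norm_cf_X hsum.summable.norm, valueAt_X, norm_mul]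
  refine (mul_le_of_le_one_left (norm_nonneg _) hz).trans_lt ?_
  exact norm_valueAt_lt_one hz hz1 hsum fun n => by rw [hcf]; exact blockProb_pos hs n

end Block

/-! ### The series `D` and `K` and their decay -/

/-- The generating function of the tail of the sum of the lengths of two successive blocks. -/
noncomputable def pairSeries (γ δ : ℝ) : PowerSeries ℝ :=
  tailSeries γ + tailSeries δ - (1 - PowerSeries.X) * (tailSeries γ * tailSeries δ)

/-- The generating function of the decrements of the correlations, up to a constant. -/
noncomputable def correlationSeries (γ δ : ℝ) : PowerSeries ℝ :=
  tailSeries γ * tailSeries δ * (pairSeries γ δ)⁻¹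

section Pair

variable {γ δ : ℝ}

theorem summable_norm_one_sub_X : Summable fun n => ‖cf (1 - PowerSeries.X) n‖ := by
  simp only [cf, map_sub]
  exact (summable_norm_cf_one.add summable_norm_cf_X).of_nonneg_of_le (fun _ => norm_nonneg _)
    fun n => norm_sub_le _ _

theorem summable_norm_tail_mul_tail (hδ : 2 < δ) (hγ : 2 < γ) :
    Summable fun n => ‖cf (tailSeries γ * tailSeries δ) n‖ :=
  summable_norm_cf_mul (summable_norm_tailSeries hγ) (summable_norm_tailSeries hδ)

theorem summable_norm_tail_add_tail (hδ : 2 < δ) (hγ : 2 < γ) :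
    Summable fun n => ‖cf (tailSeries γ + tailSeries δ) n‖ := by
  simp only [cf, map_add]
  exact ((summable_norm_tailSeries hγ).add (summable_norm_tailSeries hδ)).of_nonneg_of_le
    (fun _ => norm_nonneg _) fun n => norm_add_le _ _

theorem summable_norm_one_sub_X_mul (hδ : 2 < δ) (hγ : 2 < γ) :
    Summable fun n => ‖cf ((1 - PowerSeries.X) * (tailSeries γ * tailSeries δ)) n‖ :=
  summable_norm_cf_mul summable_norm_one_sub_X (summable_norm_tail_mul_tail hδ hγ)

theorem summable_norm_pairSeries (hδ : 2 < δ) (hγ : 2 < γ) :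
    Summable fun n => ‖cf (pairSeries γ δ) n‖ := by
  simp only [cf, pairSeries, map_sub]
  exact ((summable_norm_tail_add_tail hδ hγ).add
    (summable_norm_one_sub_X_mul hδ hγ)).of_nonneg_of_le
    (fun _ => norm_nonneg _) fun n => norm_sub_le _ _

theorem total_pairSeries (hδ : 2 < δ) (hγ : 2 < γ) :
    total (pairSeries γ δ) = meanBlock γ + meanBlock δ := by
  rw [pairSeries, total_sub (summable_norm_tail_add_tail hδ hγ)
    (summable_norm_one_sub_X_mul hδ hγ), total_mul summable_norm_one_sub_X
    (summable_norm_tail_mul_tail hδ hγ), total_sub summable_norm_cf_one summable_norm_cf_X,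
    total_one, total_X, sub_self, zero_mul, sub_zero,
    total_add (summable_norm_tailSeries hγ) (summable_norm_tailSeries hδ)]
  rfl

theorem one_sub_X_mul_pairSeries (hδ : 1 < δ) (hγ : 1 < γ) :
    (1 - PowerSeries.X) * pairSeries γ δ = 1 - blockSeries γ * blockSeries δ := by
  rw [blockSeries_eq hδ, blockSeries_eq hγ, pairSeries]
  ring

theorem constantCoeff_pairSeries (hδ : 1 < δ) (hγ : 1 < γ) :
    PowerSeries.constantCoeff (pairSeries γ δ) ≠ 0 := by
  have h := congrArg PowerSeries.constantCoeff (one_sub_X_mul_pairSeries hδ hγ)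
  simp only [map_mul, map_sub, map_one, PowerSeries.constantCoeff_X, sub_zero, one_mul,
    blockSeries, zero_mul] at h
  rw [h]
  exact one_ne_zero

/-- At `1` the value is the mean length of a pair of blocks. Elsewhere `(1 - z) D(z) = 1 - F_γ(z)
F_δ(z)`, and both factors `F` have modulus less than `1`. -/
theorem valueAt_pairSeries_ne_zero (hδ : 2 < δ) (hγ : 2 < γ) {z : ℂ} (hz : ‖z‖ ≤ 1) :
    valueAt z (pairSeries γ δ) ≠ 0 := by
  rcases eq_or_ne z 1 with rfl | hz1
  · rw [valueAt_one_left, total_pairSeries hδ hγ]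
    exact_mod_cast (add_pos (meanBlock_pos hγ) (meanBlock_pos hδ)).ne'
  · intro h0
    have hδ1 : 1 < δ := by linarith
    have hγ1 : 1 < γ := by linarith
    have hsum : ∀ s : ℝ, 1 < s → Summable fun n => ‖cf (blockSeries s) n‖ := fun s hs => by
      refine summable_norm_cf_mul summable_norm_cf_X ?_
      simpa only [cf, PowerSeries.coeff_mk] using (hasSum_blockProb hs).summable.norm
    have h := congrArg (valueAt z) (one_sub_X_mul_pairSeries hδ1 hγ1)
    rw [valueAt_mul hz summable_norm_one_sub_X (summable_norm_pairSeries hδ hγ), h0, mul_zero,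
      valueAt_sub hz summable_norm_cf_one (summable_norm_cf_mul (hsum γ hγ1) (hsum δ hδ1)),
      valueAt_mul hz (hsum γ hγ1) (hsum δ hδ1), valueAt_one] at h
    have h1 := mul_lt_one_of_nonneg_of_lt_one_left (norm_nonneg _)
      (norm_valueAt_blockSeries_lt_one hγ1 hz hz1)
      (norm_valueAt_blockSeries_lt_one hδ1 hz hz1).le
    rw [← norm_mul, ← sub_eq_zero.1 h.symm, norm_one] at h1
    exact lt_irrefl _ h1

theorem summable_norm_pairSeries_inv (hδ : 2 < δ) (hγ : 2 < γ) :
    Summable fun n => ‖cf (pairSeries γ δ)⁻¹ n‖ :=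
  summable_coeff_inv (summable_norm_pairSeries hδ hγ) fun _ hz =>
    valueAt_pairSeries_ne_zero hδ hγ hz

theorem total_pairSeries_inv (hδ : 2 < δ) (hγ : 2 < γ) :
    total (pairSeries γ δ)⁻¹ = (meanBlock γ + meanBlock δ)⁻¹ := by
  refine eq_inv_of_mul_eq_one_right ?_
  rw [← total_pairSeries hδ hγ, ← total_mul (summable_norm_pairSeries hδ hγ)
    (summable_norm_pairSeries_inv hδ hγ), PowerSeries.mul_inv_cancel _
    (constantCoeff_pairSeries (by linarith) (by linarith)), total_one]

theorem total_correlationSeries (hδ : 2 < δ) (hγ : 2 < γ) :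
    total (correlationSeries γ δ) = meanBlock γ * meanBlock δ / (meanBlock γ + meanBlock δ) := by
  rw [correlationSeries, total_mul (summable_norm_tail_mul_tail hδ hγ)
    (summable_norm_pairSeries_inv hδ hγ), total_mul (summable_norm_tailSeries hγ)
    (summable_norm_tailSeries hδ), total_pairSeries_inv hδ hγ, div_eq_mul_inv]
  rfl

/-- With `η` the rate of `T_δ`, the rate of `T_γ` is `0` and that of `T_γ T_δ` is `m_γ η`. The
factor `1 - X` annihilates rates, so `D` has rate `η` and `1 / D` has rate `-η / (m_γ + m_δ)²`. The
product rule then leaves `m_γ η / (m_γ + m_δ) - m_γ m_δ η / (m_γ + m_δ)²`, which is positive. -/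
theorem decays_correlationSeries (hδ : 2 < δ) (hγ : δ < γ) :
    Decays (δ - 1) (cf (correlationSeries γ δ))
      (meanBlock γ ^ 2 * (1 / (δ - 1) / zeta δ) / (meanBlock γ + meanBlock δ) ^ 2) := by
  have hγ2 : 2 < γ := hδ.trans hγ
  have hs : 1 < δ - 1 := by linarith
  set η := 1 / (δ - 1) / zeta δ with hη
  have hTδ : Decays (δ - 1) (cf (tailSeries δ)) η := by
    rw [cf_tailSeries]; exact decays_blockTail (by linarith)
  have hTγ : Decays (δ - 1) (cf (tailSeries γ)) 0 := by
    rw [cf_tailSeries]; exact (decays_blockTail (by linarith)).zero_of_lt (by linarith)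
  have hP := Decays.mul hs hTγ hTδ
  have hD : Decays (δ - 1) (cf (pairSeries γ δ)) η := by
    have h := (hTγ.add hTδ).sub (hP.sub hP.X_mul)
    rw [zero_add, sub_self, sub_zero] at h
    refine Tendsto.congr (fun n => ?_) h
    simp only [cf, pairSeries, sub_mul, one_mul, map_sub, map_add]
  have hE := hD.inv hs (summable_norm_pairSeries_inv hδ hγ2)
  have hK := Decays.mul hs hP hE
  rw [total_pairSeries_inv hδ hγ2, total_mul (summable_norm_tailSeries hγ2)
    (summable_norm_tailSeries hδ)] at hK
  refine (congrArg (Decays (δ - 1) (cf (correlationSeries γ δ))) ?_).mp hK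
  change meanBlock γ * meanBlock δ * _ + _ * (meanBlock γ * η + meanBlock δ * 0) = _
  have := (add_pos (meanBlock_pos hγ2) (meanBlock_pos hδ)).ne'
  field_simp
  ring

end Pair

/-! ### The first block of a sequence -/

section Blocks

theorem shift_prepend (a : Fin 2) (x : Omega) : shift (prepend a x) = x := rfl

theorem prepend_zero (a : Fin 2) (x : Omega) : prepend a x 0 = a := rfl

theorem prepend_succ (a : Fin 2) (x : Omega) (n : ℕ) : prepend a x (n + 1) = x n := rfl

theorem shift_iterate_apply (n : ℕ) (x : Omega) (i : ℕ) : shift^[n] x i = x (i + n) := by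
  induction n generalizing x with
  | zero => rfl
  | succ n ih => rw [Function.iterate_succ_apply, ih]; rfl

theorem measurable_shift : Measurable shift :=
  measurable_pi_lambda _ fun n => measurable_pi_apply (n + 1)

theorem measurable_prepend (a : Fin 2) : Measurable (prepend a) :=
  measurable_pi_lambda _ fun n => by
    cases n with
    | zero => exact measurable_const
    | succ n => exact measurable_pi_apply n

theorem continuous_prepend (a : Fin 2) : Continuous (prepend a) :=
  continuous_pi fun n => by
    cases n with
    | zero => exact continuous_const
    | succ n => exact continuous_apply n

theorem firstBlock_eq_succ_iff (x : Omega) (n : ℕ) :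
    firstBlock x = n + 1 ↔ (∀ i ≤ n, x i = x 0) ∧ x (n + 1) ≠ x 0 := by
  constructor
  · intro h
    have hmem : firstBlock x ∈ {n | x n ≠ x 0} := Nat.sInf_mem (Nat.nonempty_of_pos_sInf
      (lt_of_lt_of_eq n.succ_pos h.symm))
    refine ⟨fun i hi => ?_, h ▸ hmem⟩
    by_contra hne
    have : firstBlock x ≤ i := Nat.sInf_le hne
    omega
  · rintro ⟨h, h'⟩
    exact (firstBlock_eq n.succ_pos (fun i hi => h i (Nat.lt_succ_iff.1 hi)) h').2

theorem firstBlock_prepend_ne {a : Fin 2} {x : Omega} (h : x 0 ≠ a) :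
    firstBlock (prepend a x) = 1 :=
  (firstBlock_eq_succ_iff _ 0).2 ⟨fun i hi => by rw [Nat.le_zero.1 hi], h⟩

theorem firstBlock_prepend_succ (x : Omega) (n : ℕ) :
    firstBlock (prepend (x 0) x) = n + 2 ↔ firstBlock x = n + 1 := by
  rw [firstBlock_eq_succ_iff, firstBlock_eq_succ_iff]
  refine and_congr ⟨fun h i hi => h (i + 1) (by omega), fun h i hi => ?_⟩ Iff.rfl
  cases i with
  | zero => rfl
  | succ i => exact h i (by omega)

theorem firstBlock_prepend_zero (x : Omega) (h : firstBlock x = 0) :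
    firstBlock (prepend (x 0) x) = 0 := by
  rw [firstBlock_eq_zero_iff] at h ⊢
  intro n
  cases n with
  | zero => rfl
  | succ n => exact h n

theorem measurable_firstBlock : Measurable firstBlock := by
  have h : ∀ i, MeasurableSet {x : Omega | x i = x 0} := fun i =>
    measurableSet_eq_fun (measurable_pi_apply i) (measurable_pi_apply 0)
  refine measurable_to_countable' fun n => ?_
  cases n with
  | zero =>
    have : firstBlock ⁻¹' {0} = ⋂ i, {x : Omega | x i = x 0} := by
      ext x; simp [firstBlock_eq_zero_iff]
    rw [this]
    exact MeasurableSet.iInter h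
  | succ n =>
    have : firstBlock ⁻¹' {n + 1} =
        (⋂ i, ⋂ (_ : i ≤ n), {x : Omega | x i = x 0}) ∩ {x : Omega | x (n + 1) = x 0}ᶜ := by
      ext x; simp [firstBlock_eq_succ_iff]
    rw [this]
    exact (MeasurableSet.iInter fun i => MeasurableSet.iInter fun _ => h i).inter (h _).compl

/-- The exponent attached to a symbol. -/
noncomputable def symbolExponent (γ δ : ℝ) (a : Fin 2) : ℝ := if a = 0 then γ else δ

/-- The cylinder `[a]`. -/
def cyl (a : Fin 2) : Set Omega := {x | x 0 = a}

/-- The event that the `q`-th symbol is `0`. -/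
def zeroAt (q : ℕ) : Set Omega := {x | x q = 0}

/-- The sequences whose first block consists of `n + 1` symbols `a`. -/
def blockSet (a : Fin 2) (n : ℕ) : Set Omega := {x | x 0 = a ∧ firstBlock x = n + 1}

theorem exponent_eq {γ δ : ℝ} {a : Fin 2} {x : Omega} (hx : x 0 = a) :
    exponent γ δ x = symbolExponent γ δ a := by
  rw [exponent, hx]; rfl

theorem measurableSet_apply_eq (i : ℕ) (a : Fin 2) : MeasurableSet {x : Omega | x i = a} :=
  measurableSet_eq_fun (measurable_pi_apply i) measurable_const

theorem measurableSet_cyl (a : Fin 2) : MeasurableSet (cyl a) := measurableSet_apply_eq 0 a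

theorem measurableSet_zeroAt (q : ℕ) : MeasurableSet (zeroAt q) := measurableSet_apply_eq q 0

theorem measurableSet_blockSet (a : Fin 2) (n : ℕ) : MeasurableSet (blockSet a n) :=
  (measurableSet_cyl a).inter (measurable_firstBlock (measurableSet_singleton (n + 1)))

theorem pairwise_disjoint_blockSet (a : Fin 2) :
    Pairwise (Function.onFun Disjoint (blockSet a)) := fun i j hij =>
  Set.disjoint_left.2 fun x hi hj => hij (by have := hi.2.symm.trans hj.2; omega)

theorem eq_of_mem_blockSet {a : Fin 2} {n i : ℕ} {x : Omega} (hx : x ∈ blockSet a n)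
    (hi : i ≤ n) : x i = a :=
  (((firstBlock_eq_succ_iff x n).1 hx.2).1 i hi).trans hx.1

theorem shift_mem_of_mem_blockSet {a b : Fin 2} (hab : a ≠ b) {n : ℕ} {x : Omega}
    (hx : x ∈ blockSet a n) : shift^[n + 1] x ∈ cyl b := by
  have h := ((firstBlock_eq_succ_iff x n).1 hx.2).2
  rw [hx.1] at h
  change shift^[n + 1] x 0 = b
  rw [shift_iterate_apply, zero_add]
  omega

/-- Removing the first symbol exhausts a block of length one and shortens any longer block by one
(the next lemma). These are the base and the step of the induction that proves independence of the
first block. -/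
theorem preimage_prepend_blockSet_zero {a b : Fin 2} (hab : a ≠ b) (A : Set Omega) :
    prepend a ⁻¹' (blockSet a 0 ∩ shift^[1] ⁻¹' A) = cyl b ∩ A := by
  ext x
  refine ⟨fun h => ⟨shift_mem_of_mem_blockSet hab h.1, h.2⟩, fun h => ⟨⟨rfl, ?_⟩, h.2⟩⟩
  exact firstBlock_prepend_ne (by rw [show x 0 = b from h.1]; exact hab.symm)

theorem preimage_prepend_blockSet_succ (a : Fin 2) (n : ℕ) (A : Set Omega) :
    prepend a ⁻¹' (blockSet a (n + 1) ∩ shift^[n + 2] ⁻¹' A) =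
      blockSet a n ∩ shift^[n + 1] ⁻¹' A := by
  ext x
  constructor
  · rintro ⟨h, h'⟩
    have h0 : x 0 = a := eq_of_mem_blockSet (i := 1) h (by omega)
    subst h0
    exact ⟨⟨rfl, (firstBlock_prepend_succ x n).1 h.2⟩, h'⟩
  · rintro ⟨⟨h0, h⟩, h'⟩
    subst h0
    exact ⟨⟨rfl, (firstBlock_prepend_succ x n).2 h⟩, h'⟩

end Blocks

/-! ### The potential and the eigenfunction in terms of the block law -/

section Potential

variable {γ δ : ℝ}

theorem one_lt_symbolExponent (hδ : 1 < δ) (hγ : 1 < γ) (a : Fin 2) :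
    1 < symbolExponent γ δ a := by
  unfold symbolExponent; split_ifs <;> assumption

theorem weight_zero (s : ℝ) : weight s 0 = 1 := by simp [weight]

theorem exp_potential_one (hδ : 1 < δ) (hγ : 1 < γ) {a : Fin 2} {x : Omega}
    (hx : x ∈ blockSet a 0) :
    Real.exp (potential γ δ x) = blockProb (symbolExponent γ δ a) 0 := by
  have h := hx.2
  rw [zero_add] at h
  rw [potential, if_neg (by omega), if_pos h, exponent_eq hx.1, Real.exp_neg,
    Real.exp_log (zeta_pos (one_lt_symbolExponent hδ hγ a)), blockProb, weight_zero, one_div]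

/-- As a ratio of successive weights, the exponential of the potential telescopes along a block;
together with the factor `1 / ζ` at length one the product is `blockProb`. -/
theorem exp_potential_succ {a : Fin 2} {n : ℕ} {x : Omega} (hx : x ∈ blockSet a (n + 1)) :
    Real.exp (potential γ δ x) =
      weight (symbolExponent γ δ a) (n + 1) / weight (symbolExponent γ δ a) n := by
  have h := hx.2
  rw [potential, if_neg (by omega), if_neg (by omega), exponent_eq hx.1, h]
  have h1 : (0 : ℝ) < (n : ℝ) + 1 := by positivity
  have h2 : (0 : ℝ) < (n : ℝ) + 1 + 1 := by positivity
  push_cast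
  rw [add_sub_cancel_right, weight, weight, ← Real.div_rpow (by positivity) (by positivity),
    mul_comm, ← Real.rpow_def_of_pos (by positivity)]
  push_cast
  rfl

theorem exp_potential_zero {x : Omega} (hx : firstBlock x = 0) :
    Real.exp (potential γ δ x) = 1 := by
  rw [potential, if_pos hx, Real.exp_zero]

theorem exp_potential_le_one (hδ : 1 < δ) (hγ : 1 < γ) (x : Omega) :
    Real.exp (potential γ δ x) ≤ 1 := by
  have hs := one_lt_symbolExponent hδ hγ (x 0)
  rcases h : firstBlock x with _ | _ | n
  · exact (exp_potential_zero h).le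
  · rw [exp_potential_one (a := x 0) hδ hγ ⟨rfl, h⟩, ← blockTail_zero hs, blockTail_eq hs]
    linarith [blockTail_nonneg hs 1]
  · rw [exp_potential_succ (a := x 0) ⟨rfl, h⟩]
    refine div_le_one_of_le₀ ?_ (weight_pos _ _).le
    exact Real.rpow_le_rpow_of_nonpos (by positivity) (by push_cast; linarith) (by linarith)

theorem measurable_exponent : Measurable (exponent γ δ) :=
  Measurable.ite (measurableSet_cyl 0) measurable_const measurable_const

theorem measurable_potential : Measurable (potential γ δ) := by
  have hf := measurable_firstBlock
  have hc : Measurable fun x => (firstBlock x : ℝ) := measurable_from_nat.comp hf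
  refine Measurable.ite (hf (measurableSet_singleton 0)) measurable_const
    (Measurable.ite (hf (measurableSet_singleton 1)) ?_ ?_)
  · have : (fun x => -Real.log (zeta (exponent γ δ x))) =
        fun x : Omega => if x 0 = 0 then -Real.log (zeta γ) else -Real.log (zeta δ) := by
      ext x; unfold exponent; split_ifs <;> rfl
    rw [this]
    exact Measurable.ite (measurableSet_cyl 0) measurable_const measurable_const
  · exact measurable_exponent.neg.mul (Real.measurable_log.comp (hc.div (hc.sub_const 1)))

/-- Split off the first term of the tail: it gives the summand `1`. In this form, integrating
against the block law replaces masses by tails, so the integral is finite as soon as the mean length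
is. -/
theorem eigenfunction_eq (hδ : 1 < δ) (hγ : 1 < γ) {a : Fin 2} {n : ℕ} {x : Omega}
    (hx : x ∈ blockSet a n) :
    eigenfunction γ δ x = ENNReal.ofReal
      (blockTail (symbolExponent γ δ a) n / blockProb (symbolExponent γ δ a) n) := by
  have hs := one_lt_symbolExponent hδ hγ a
  have hn : (0 : ℝ) < (n : ℝ) + 1 := by positivity
  rw [eigenfunction, if_neg (by rw [hx.2]; omega), exponent_eq hx.1, hx.2, blockTail, blockProb,
    div_div_div_cancel_right₀ (zeta_pos hs).ne', (summable_weight_add hs n).tsum_eq_zero_add,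
    add_zero, add_div, div_self (weight_pos _ n).ne', weight, Real.rpow_neg hn.le, div_inv_eq_mul,
    mul_comm (∑' _, _)]
  unfold weight
  push_cast
  congr 6 with j
  congr 1
  ring

theorem measurable_eigenfunction (hδ : 1 < δ) (hγ : 1 < γ) : Measurable (eigenfunction γ δ) := by
  have : eigenfunction γ δ = fun x => if firstBlock x = 0 then ⊤ else
      if x 0 = 0 then ENNReal.ofReal (blockTail γ (firstBlock x - 1) /
        blockProb γ (firstBlock x - 1)) else ENNReal.ofReal (blockTail δ (firstBlock x - 1) /
        blockProb δ (firstBlock x - 1)) := by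
    ext x
    rcases h : firstBlock x with _ | n
    · rw [eigenfunction, if_pos h, if_pos rfl]
    · rw [eigenfunction_eq hδ hγ (a := x 0) ⟨rfl, h⟩, if_neg n.succ_ne_zero, symbolExponent]
      split_ifs <;> rfl
  rw [this]
  have hf := measurable_firstBlock
  refine Measurable.ite (hf (measurableSet_singleton 0)) measurable_const
    (Measurable.ite (measurableSet_cyl 0) ?_ ?_)
  · exact (measurable_from_nat (f := fun n => ENNReal.ofReal (blockTail γ (n - 1) /
      blockProb γ (n - 1)))).comp hf
  · exact (measurable_from_nat (f := fun n => ENNReal.ofReal (blockTail δ (n - 1) /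
      blockProb δ (n - 1)))).comp hf

/-- The weight `e^{g(ax)}` with which the Ruelle operator counts the preimage `ax` of `x`. -/
noncomputable def branchWeight (γ δ : ℝ) (a : Fin 2) (x : Omega) : ℝ≥0∞ :=
  ENNReal.ofReal (Real.exp (potential γ δ (prepend a x)))

theorem measurable_branchWeight (a : Fin 2) : Measurable (branchWeight γ δ a) :=
  (Real.measurable_exp.comp (measurable_potential.comp (measurable_prepend a))).ennreal_ofReal

theorem branchWeight_le_one (hδ : 1 < δ) (hγ : 1 < γ) (a : Fin 2) (x : Omega) :
    branchWeight γ δ a x ≤ 1 := by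
  rw [branchWeight, ← ENNReal.ofReal_one]
  exact ENNReal.ofReal_le_ofReal (exp_potential_le_one hδ hγ _)

/-- The eigenfunction is fixed by the Ruelle operator. -/
theorem sum_branchWeight_mul_eigenfunction (hδ : 1 < δ) (hγ : 1 < γ) (x : Omega) :
    ∑ a, branchWeight γ δ a x * eigenfunction γ δ (prepend a x) = eigenfunction γ δ x := by
  obtain ⟨b, hb⟩ : ∃ b, b ≠ x 0 := exists_ne _
  have hsum : ∀ f : Fin 2 → ℝ≥0∞, ∑ a, f a = f (x 0) + f b := fun f => by
    rw [Fin.sum_univ_two]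
    rcases (show (x 0 = 0 ∧ b = 1) ∨ (x 0 = 1 ∧ b = 0) by omega) with ⟨h, h'⟩ | ⟨h, h'⟩
    · rw [h, h']
    · rw [h, h', add_comm]
  have hs := one_lt_symbolExponent hδ hγ (x 0)
  have hs' := one_lt_symbolExponent hδ hγ b
  -- The branch with the other symbol opens a block of length one and contributes `1`. The branch
  -- that prolongs the block contributes `T_{n+1} / p_n`, and the sum is `T_n / p_n`.
  have hother : branchWeight γ δ b x * eigenfunction γ δ (prepend b x) = 1 := by
    have hm : prepend b x ∈ blockSet b 0 := ⟨rfl, firstBlock_prepend_ne hb.symm⟩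
    rw [branchWeight, exp_potential_one hδ hγ hm, eigenfunction_eq hδ hγ hm,
      ← ENNReal.ofReal_mul (blockProb_pos hs' 0).le, mul_div_cancel₀ _ (blockProb_pos hs' 0).ne',
      blockTail_zero hs', ENNReal.ofReal_one]
  rw [hsum, hother]
  rcases h : firstBlock x with _ | n
  · have h' := firstBlock_prepend_zero x h
    rw [branchWeight, exp_potential_zero h', eigenfunction, eigenfunction, if_pos h, if_pos h']
    simp
  · have hm : prepend (x 0) x ∈ blockSet (x 0) (n + 1) :=
      ⟨rfl, (firstBlock_prepend_succ x n).2 h⟩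
    have hp := blockProb_pos hs n
    have hw := weight_pos (symbolExponent γ δ (x 0)) n
    have hw' := weight_pos (symbolExponent γ δ (x 0)) (n + 1)
    have hz := zeta_pos hs
    rw [branchWeight, exp_potential_succ hm, eigenfunction_eq hδ hγ hm,
      eigenfunction_eq hδ hγ (a := x 0) ⟨rfl, h⟩, ← ENNReal.ofReal_mul (by positivity),
      ← ENNReal.ofReal_one, ← ENNReal.ofReal_add _ zero_le_one]
    · congr 1
      rw [blockTail_eq hs n, add_div, div_self hp.ne', add_comm]
      unfold blockProb
      field_simp
    · exact mul_nonneg (by positivity)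
        (div_nonneg (blockTail_nonneg hs _) (blockProb_pos hs _).le)

end Potential

/-! ### Fixed measures of the dual operator and renewal equations -/

section Conformal

variable {γ δ : ℝ} {ν : Measure Omega}

/-- The image of a measure under the dual of the Ruelle operator. -/
noncomputable def dualRuelle (γ δ : ℝ) (ν : Measure Omega) : Measure Omega :=
  Measure.sum fun a : Fin 2 => (ν.withDensity (branchWeight γ δ a)).map (prepend a)

theorem lintegral_dualRuelle (ν : Measure Omega) {ψ : Omega → ℝ≥0∞} (hψ : Measurable ψ) :
    ∫⁻ x, ψ x ∂(dualRuelle γ δ ν) = ∑ a, ∫⁻ x, branchWeight γ δ a x * ψ (prepend a x) ∂ν := by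
  rw [dualRuelle, lintegral_sum_measure, tsum_fintype]
  refine Finset.sum_congr rfl fun a _ => ?_
  rw [lintegral_map hψ (measurable_prepend a), lintegral_withDensity_eq_lintegral_mul _
    (measurable_branchWeight a) (g := fun x => ψ (prepend a x)) (hψ.comp (measurable_prepend a))]
  rfl

theorem isFiniteMeasure_dualRuelle (hδ : 1 < δ) (hγ : 1 < γ) (ν : Measure Omega)
    [IsProbabilityMeasure ν] : IsFiniteMeasure (dualRuelle γ δ ν) := by
  refine ⟨?_⟩
  rw [← lintegral_one, lintegral_dualRuelle ν measurable_const]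
  refine ENNReal.sum_lt_top.2 fun a _ => ?_
  simp only [mul_one]
  calc _ ≤ ∫⁻ _, 1 ∂ν := lintegral_mono (branchWeight_le_one hδ hγ a)
    _ < ⊤ := by simp

theorem integral_dualRuelle [IsProbabilityMeasure ν]
    (hδ : 1 < δ) (hγ : 1 < γ) {ψ : Omega → ℝ} (hψ : Continuous ψ) :
    ∫ x, ψ x ∂(dualRuelle γ δ ν) = ∫ x, ruelle (potential γ δ) ψ x ∂ν := by
  obtain ⟨C, hC⟩ := isCompact_univ.exists_bound_of_continuousOn hψ.continuousOn
  have hfin := isFiniteMeasure_dualRuelle hδ hγ ν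
  have hint : Integrable ψ (dualRuelle γ δ ν) :=
    Integrable.of_bound hψ.aestronglyMeasurable C (ae_of_all _ fun x => hC x (Set.mem_univ x))
  have hg : ∀ a, Measurable fun x => Real.exp (potential γ δ (prepend a x)) := fun a =>
    Real.measurable_exp.comp (measurable_potential.comp (measurable_prepend a))
  unfold ruelle
  rw [integral_finsetSum]
  · rw [dualRuelle, integral_sum_measure hint, tsum_fintype]
    refine Finset.sum_congr rfl fun a _ => ?_
    rw [integral_map (measurable_prepend a).aemeasurable hψ.aestronglyMeasurable,
      integral_withDensity_eq_integral_toReal_smul (measurable_branchWeight a)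
        (ae_of_all _ fun x => ENNReal.ofReal_lt_top)]
    refine integral_congr_ae (ae_of_all _ fun x => ?_)
    simp only [branchWeight, smul_eq_mul, ENNReal.toReal_ofReal (Real.exp_pos _).le]
  · intro a _
    refine Integrable.of_bound ((hg a).aestronglyMeasurable.mul
      (hψ.comp (continuous_prepend a)).aestronglyMeasurable) C (ae_of_all _ fun x => ?_)
    rw [norm_mul, Real.norm_of_nonneg (Real.exp_pos _).le]
    exact (mul_le_of_le_one_left (norm_nonneg _) (exp_potential_le_one hδ hγ _)).trans
      (hC _ (Set.mem_univ _))

/-- Finite measures are determined by integrals of continuous functions. The equality of measures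
can then be tested on cylinders and on unbounded functions such as the eigenfunction. -/
theorem isRuelleFixed_iff [IsProbabilityMeasure ν] (hδ : 1 < δ) (hγ : 1 < γ) :
    IsRuelleFixed (potential γ δ) ν ↔ dualRuelle γ δ ν = ν := by
  have hfin := isFiniteMeasure_dualRuelle hδ hγ ν
  constructor
  · intro h
    refine ext_of_forall_integral_eq_of_IsFiniteMeasure fun f => ?_
    rw [integral_dualRuelle hδ hγ f.continuous, h f f.continuous]
  · intro h ψ hψ
    rw [← integral_dualRuelle hδ hγ hψ, h]

/-- If the potential is constant on a set of sequences that begin with `a`, then the measure of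
that set is a multiple of the measure of its image under the shift. -/
theorem measure_eq_mul_of_exp_potential_eq (hν : dualRuelle γ δ ν = ν) {a : Fin 2} {S : Set Omega}
    (hS : MeasurableSet S) (ha : S ⊆ cyl a) {c : ℝ}
    (hc : ∀ x ∈ S, Real.exp (potential γ δ x) = c) :
    ν S = ENNReal.ofReal c * ν (prepend a ⁻¹' S) := by
  have h := lintegral_dualRuelle (γ := γ) (δ := δ) ν (measurable_one.indicator hS)
  rw [hν, lintegral_indicator_one hS, Finset.sum_eq_single a] at h
  · rw [h, ← lintegral_indicator_one (measurable_prepend a hS), ← lintegral_const_mul]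
    · refine lintegral_congr fun x => ?_
      by_cases hx : prepend a x ∈ S
      · rw [Set.indicator_of_mem hx, Set.indicator_of_mem (by exact hx), branchWeight, hc _ hx]
        rfl
      · rw [Set.indicator_of_notMem hx, Set.indicator_of_notMem (by exact hx), mul_zero, mul_zero]
    · exact measurable_one.indicator (measurable_prepend a hS)
  · intro b _ hb
    refine (lintegral_congr fun x => ?_).trans lintegral_zero
    rw [Set.indicator_of_notMem (fun hx => hb (ha hx)), mul_zero]
  · simp

theorem measurable_shift_iterate (n : ℕ) : Measurable shift^[n] := measurable_shift.iterate n

/-- The first block has the law `blockProb` and is independent of what follows it. -/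
theorem measure_blockSet_inter (hδ : 1 < δ) (hγ : 1 < γ) (hν : dualRuelle γ δ ν = ν)
    {a b : Fin 2} (hab : a ≠ b) (n : ℕ) {A : Set Omega} (hA : MeasurableSet A) :
    ν (blockSet a n ∩ shift^[n + 1] ⁻¹' A) =
      ENNReal.ofReal (blockProb (symbolExponent γ δ a) n) * ν (cyl b ∩ A) := by
  have hs := one_lt_symbolExponent hδ hγ a
  induction n with
  | zero =>
    rw [measure_eq_mul_of_exp_potential_eq hν (a := a)
      ((measurableSet_blockSet a 0).inter (measurable_shift_iterate 1 hA)) (fun x hx => hx.1.1)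
      (fun x hx => exp_potential_one hδ hγ hx.1), preimage_prepend_blockSet_zero hab]
  | succ n ih =>
    rw [measure_eq_mul_of_exp_potential_eq hν (a := a)
      ((measurableSet_blockSet a (n + 1)).inter (measurable_shift_iterate (n + 2) hA))
      (fun x hx => hx.1.1) (fun x hx => exp_potential_succ hx.1), preimage_prepend_blockSet_succ,
      ih, ← mul_assoc, ← ENNReal.ofReal_mul (div_pos (weight_pos _ _) (weight_pos _ _)).le]
    congr 2
    have := (weight_pos (symbolExponent γ δ a) n).ne'
    unfold blockProb
    field_simp

theorem measure_blockSet (hδ : 1 < δ) (hγ : 1 < γ) (hν : dualRuelle γ δ ν = ν)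
    {a b : Fin 2} (hab : a ≠ b) (n : ℕ) :
    ν (blockSet a n) = ENNReal.ofReal (blockProb (symbolExponent γ δ a) n) * ν (cyl b) := by
  simpa using measure_blockSet_inter hδ hγ hν hab n MeasurableSet.univ

theorem tsum_ofReal_blockProb {s : ℝ} (hs : 1 < s) :
    ∑' n, ENNReal.ofReal (blockProb s n) = 1 := by
  rw [← ENNReal.ofReal_tsum_of_nonneg (fun n => (blockProb_pos hs n).le)
    (hasSum_blockProb hs).summable, (hasSum_blockProb hs).tsum_eq, ENNReal.ofReal_one]

theorem cyl_eq_union (a : Fin 2) :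
    cyl a = (cyl a ∩ {x | firstBlock x = 0}) ∪ ⋃ n, blockSet a n := by
  ext x
  simp only [Set.mem_union, Set.mem_inter_iff, Set.mem_iUnion, blockSet, Set.mem_ofPred_eq, cyl]
  rcases h : firstBlock x with _ | n
  · simp
  · simp

theorem measure_cyl_eq_add (hδ : 1 < δ) (hγ : 1 < γ) (hν : dualRuelle γ δ ν = ν)
    {a b : Fin 2} (hab : a ≠ b) :
    ν (cyl a) = ν (cyl a ∩ {x | firstBlock x = 0}) + ν (cyl b) := by
  conv_lhs => rw [cyl_eq_union]
  rw [measure_union _ (MeasurableSet.iUnion (measurableSet_blockSet a)),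
    measure_iUnion (pairwise_disjoint_blockSet a) (measurableSet_blockSet a)]
  · simp only [measure_blockSet hδ hγ hν hab]
    rw [ENNReal.tsum_mul_right, tsum_ofReal_blockProb (one_lt_symbolExponent hδ hγ a), one_mul]
  · rw [Set.disjoint_iUnion_right]
    intro n
    refine Set.disjoint_left.2 fun x hx hx' => ?_
    have := (show firstBlock x = 0 from hx.2).symm.trans hx'.2
    omega

/-- The mass of `[a]` exceeds that of `[b]` by the mass of the constant sequence in `[a]`, and the
same holds with the symbols exchanged. In a finite measure both excesses must vanish. -/
theorem measure_firstBlock_zero [IsProbabilityMeasure ν]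
    (hδ : 1 < δ) (hγ : 1 < γ) (hν : dualRuelle γ δ ν = ν)
    (a : Fin 2) : ν (cyl a ∩ {x | firstBlock x = 0}) = 0 := by
  obtain ⟨b, hab⟩ := exists_ne a
  have h1 := measure_cyl_eq_add hδ hγ hν hab.symm
  have h2 := measure_cyl_eq_add hδ hγ hν hab
  rw [h2, ← add_assoc] at h1
  have h3 := ENNReal.add_right_inj (a := ν (cyl a)) (measure_ne_top ν _)
    (b := ν (cyl a ∩ {x | firstBlock x = 0}) + ν (cyl b ∩ {x | firstBlock x = 0})) (c := 0)
  rw [add_zero, add_comm (ν (cyl a)), ← h1] at h3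
  exact (add_eq_zero.1 (h3.1 rfl)).1

theorem measure_cyl [IsProbabilityMeasure ν]
    (hδ : 1 < δ) (hγ : 1 < γ) (hν : dualRuelle γ δ ν = ν) (a : Fin 2) :
    ν (cyl a) = 1 / 2 := by
  obtain ⟨b, hab⟩ := exists_ne a
  have h1 := measure_cyl_eq_add hδ hγ hν hab.symm
  rw [measure_firstBlock_zero hδ hγ hν, zero_add] at h1
  have h2 : (cyl a)ᶜ = cyl b := by
    ext x
    change x 0 ≠ a ↔ x 0 = b
    omega
  have h3 := measure_add_measure_compl (μ := ν) (measurableSet_cyl a)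
  rw [h2, ← h1, measure_univ, ← two_mul] at h3
  rw [ENNReal.eq_div_iff (by norm_num) (by norm_num), h3]

/-- Integration over `[a]` is integration over the values of the first block. -/
theorem lintegral_cyl_inter [IsProbabilityMeasure ν]
    (hδ : 1 < δ) (hγ : 1 < γ) (hν : dualRuelle γ δ ν = ν)
    (a : Fin 2) {S : Set Omega} (hS : MeasurableSet S) (φ : Omega → ℝ≥0∞) {c : ℕ → ℝ≥0∞}
    (hφ : ∀ n, ∀ x ∈ blockSet a n, φ x = c n) :
    ∫⁻ x in cyl a ∩ S, φ x ∂ν = ∑' n, c n * ν (blockSet a n ∩ S) := by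
  have hae : (cyl a ∩ S : Set Omega) =ᵐ[ν] ⋃ n, blockSet a n ∩ S := by
    rw [← Set.iUnion_inter]
    refine ae_eq_set_inter ?_ (ae_eq_refl S)
    conv_lhs => rw [cyl_eq_union]
    refine (ae_eq_set_union (ae_eq_empty.2 (measure_firstBlock_zero hδ hγ hν a))
      (ae_eq_refl _)).trans ?_
    rw [Set.empty_union]
    exact ae_eq_refl _
  rw [setLIntegral_congr hae, lintegral_iUnion
    (fun n => (measurableSet_blockSet a n).inter hS)
    (fun i j hij => (pairwise_disjoint_blockSet a hij).mono Set.inter_subset_left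
      Set.inter_subset_left)]
  refine tsum_congr fun n => ?_
  rw [setLIntegral_congr_fun ((measurableSet_blockSet a n).inter hS) (fun x hx => hφ n x hx.1),
    setLIntegral_const]

theorem blockSet_inter_zeroAt_of_lt {a : Fin 2} {n q : ℕ} (h : n < q) :
    blockSet a n ∩ zeroAt q = blockSet a n ∩ shift^[n + 1] ⁻¹' zeroAt (q - (n + 1)) := by
  ext x
  refine and_congr Iff.rfl ?_
  change x q = 0 ↔ shift^[n + 1] x (q - (n + 1)) = 0
  rw [shift_iterate_apply, Nat.sub_add_cancel h]

/-- The measure of the sequences that have first symbol `a` and `q`-th symbol `0`. -/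
noncomputable def hit (ν : Measure Omega) (a : Fin 2) (q : ℕ) : ℝ := ν.real (cyl a ∩ zeroAt q)

/-- If `q ≤ n`, the `q`-th symbol still lies in the first block and equals `a`. The value `hit ν a
0` covers both symbols: it is `1/2`, the mass of `cyl b`, for `a = 0`, and it vanishes for `a = 1`.
If `n < q`, the sequence restarts in `b` after `n + 1` symbols. -/
theorem measure_blockSet_inter_zeroAt [IsProbabilityMeasure ν]
    (hδ : 1 < δ) (hγ : 1 < γ) (hν : dualRuelle γ δ ν = ν)
    {a b : Fin 2} (hab : a ≠ b) (n q : ℕ) :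
    ν (blockSet a n ∩ zeroAt q) = ENNReal.ofReal (blockProb (symbolExponent γ δ a) n *
      if q ≤ n then hit ν a 0 else hit ν b (q - (n + 1))) := by
  rw [ENNReal.ofReal_mul (blockProb_pos (one_lt_symbolExponent hδ hγ a) n).le]
  split_ifs with h
  · by_cases ha : a = 0
    · have h1 : blockSet a n ∩ zeroAt q = blockSet a n :=
        Set.inter_eq_left.2 fun x hx => (eq_of_mem_blockSet hx h).trans ha
      have h2 : cyl a ∩ zeroAt 0 = cyl a := Set.inter_eq_left.2 fun x hx => Eq.trans hx ha
      rw [h1, measure_blockSet hδ hγ hν hab, hit, h2, ofReal_measureReal,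
        measure_cyl hδ hγ hν, measure_cyl hδ hγ hν]
    · have h1 : blockSet a n ∩ zeroAt q = ∅ :=
        Set.eq_empty_of_forall_notMem fun x hx => ha ((eq_of_mem_blockSet hx.1 h).symm.trans hx.2)
      have h2 : cyl a ∩ zeroAt 0 = ∅ :=
        Set.eq_empty_of_forall_notMem fun x hx =>
          ha (Eq.trans (Eq.symm hx.1) hx.2)
      rw [h1, hit, h2, measureReal_empty, measure_empty, ENNReal.ofReal_zero, mul_zero]
  · rw [blockSet_inter_zeroAt_of_lt (not_le.1 h),
      measure_blockSet_inter hδ hγ hν hab n (measurableSet_zeroAt _), hit, ofReal_measureReal]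

theorem hit_nonneg (a : Fin 2) (q : ℕ) : 0 ≤ hit ν a q := measureReal_nonneg

theorem hit_zero_zero [IsProbabilityMeasure ν]
    (hδ : 1 < δ) (hγ : 1 < γ) (hν : dualRuelle γ δ ν = ν) :
    hit ν 0 0 = 1 / 2 := by
  have h2 : cyl 0 ∩ zeroAt 0 = cyl 0 := Set.inter_self _
  rw [hit, h2, measureReal_def, measure_cyl hδ hγ hν]
  norm_num

theorem hit_one_zero : hit ν 1 0 = 0 := by
  have h2 : cyl 1 ∩ zeroAt 0 = ∅ :=
    Set.eq_empty_of_forall_notMem fun x hx => one_ne_zero (Eq.trans (Eq.symm hx.1) hx.2)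
  rw [hit, h2, measureReal_empty]

theorem summable_mul_ite {p h : ℕ → ℝ} (hp : Summable p) {c : ℝ} (q : ℕ) :
    Summable fun n => p n * (if q ≤ n then c else h (q - (n + 1))) := by
  refine (summable_nat_add_iff q).1 ?_
  simp only [Nat.le_add_left, if_true]
  exact ((summable_nat_add_iff q).2 hp).mul_right c

/-- The renewal convolution of a sequence `p` with the two sequences of hitting probabilities. -/
theorem tsum_mul_ite {p h : ℕ → ℝ} (hp : Summable p) {c : ℝ} (q : ℕ) :
    ∑' n, p n * (if q ≤ n then c else h (q - (n + 1))) =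
      (∑' j, p (q + j)) * c +
        cf (PowerSeries.X * (PowerSeries.mk p * PowerSeries.mk h)) q := by
  rw [← (summable_mul_ite hp q).sum_add_tsum_nat_add q, add_comm]
  congr 1
  · rw [← tsum_mul_right]
    refine tsum_congr fun j => ?_
    rw [if_pos (Nat.le_add_left q j), add_comm j q]
  · cases q with
    | zero => simp [cf]
    | succ q =>
      rw [cf, PowerSeries.coeff_succ_X_mul, PowerSeries.coeff_mul,
        Finset.Nat.sum_antidiagonal_eq_sum_range_succ (fun i j =>
          PowerSeries.coeff i (PowerSeries.mk p) * PowerSeries.coeff j (PowerSeries.mk h))]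
      refine Finset.sum_congr rfl fun n hn => ?_
      rw [Finset.mem_range] at hn
      rw [if_neg (by omega), PowerSeries.coeff_mk, PowerSeries.coeff_mk, Nat.succ_sub_succ]

theorem ite_hit_nonneg (a b : Fin 2) (n q : ℕ) :
    0 ≤ if q ≤ n then hit ν a 0 else hit ν b (q - (n + 1)) := by
  split_ifs <;> exact hit_nonneg _ _

/-- The renewal equation for the hitting probabilities. -/
theorem hit_eq [IsProbabilityMeasure ν]
    (hδ : 1 < δ) (hγ : 1 < γ) (hν : dualRuelle γ δ ν = ν) {a b : Fin 2}
    (hab : a ≠ b) (q : ℕ) :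
    hit ν a q = blockTail (symbolExponent γ δ a) q * hit ν a 0 +
      cf (blockSeries (symbolExponent γ δ a) * PowerSeries.mk (hit ν b)) q := by
  have hs := one_lt_symbolExponent hδ hγ a
  have hp := (hasSum_blockProb hs).summable
  have h := lintegral_cyl_inter hδ hγ hν a (measurableSet_zeroAt q) 1 (c := 1)
    (fun _ _ _ => rfl)
  simp only [Pi.one_apply, one_mul, measure_blockSet_inter_zeroAt hδ hγ hν hab,
    lintegral_const, Measure.restrict_apply_univ] at h
  rw [← ENNReal.ofReal_tsum_of_nonneg
    (fun n => mul_nonneg (blockProb_pos hs n).le (ite_hit_nonneg a b n q))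
    (summable_mul_ite hp q), tsum_mul_ite hp] at h
  have h2 : ∑' j, blockProb (symbolExponent γ δ a) (q + j) =
      blockTail (symbolExponent γ δ a) q := tsum_div_const
  rw [h2, ← mul_assoc] at h
  rw [hit, measureReal_def, h, ENNReal.toReal_ofReal]
  · rfl
  · rw [← h2, mul_assoc, ← tsum_mul_ite hp]
    exact tsum_nonneg fun n => mul_nonneg (blockProb_pos hs n).le (ite_hit_nonneg a b n q)

/-- The integral of the eigenfunction over the sequences with first symbol `a` and `q`-th
symbol `0`. -/
theorem lintegral_eigenfunction_eq [IsProbabilityMeasure ν]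
    (hδ : 2 < δ) (hγ : 2 < γ) (hν : dualRuelle γ δ ν = ν)
    {a b : Fin 2} (hab : a ≠ b) (q : ℕ) :
    ∫⁻ x in cyl a ∩ zeroAt q, eigenfunction γ δ x ∂ν = ENNReal.ofReal
      ((∑' j, blockTail (symbolExponent γ δ a) (q + j)) * hit ν a 0 +
      cf (PowerSeries.X * (tailSeries (symbolExponent γ δ a) * PowerSeries.mk (hit ν b))) q) := by
  have hδ1 : 1 < δ := by linarith
  have hγ1 : 1 < γ := by linarith
  have hs := one_lt_symbolExponent hδ1 hγ1 a
  have hs2 : 2 < symbolExponent γ δ a := by unfold symbolExponent; split_ifs <;> assumption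
  have hp := summable_blockTail hs2
  rw [lintegral_cyl_inter hδ1 hγ1 hν a (measurableSet_zeroAt q) _
    (fun n x hx => eigenfunction_eq hδ1 hγ1 hx)]
  simp only [measure_blockSet_inter_zeroAt hδ1 hγ1 hν hab]
  rw [tailSeries, ← tsum_mul_ite hp, ENNReal.ofReal_tsum_of_nonneg
    (fun n => mul_nonneg (blockTail_nonneg hs n) (ite_hit_nonneg a b n q)) (summable_mul_ite hp q)]
  refine tsum_congr fun n => ?_
  have hpos := blockProb_pos hs n
  rw [← ENNReal.ofReal_mul (div_nonneg (blockTail_nonneg hs n) hpos.le), ← mul_assoc,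
    div_mul_cancel₀ _ hpos.ne']

theorem lintegral_cyl_eigenfunction [IsProbabilityMeasure ν]
    (hδ : 2 < δ) (hγ : 2 < γ) (hν : dualRuelle γ δ ν = ν)
    (a : Fin 2) :
    ∫⁻ x in cyl a, eigenfunction γ δ x ∂ν =
      ENNReal.ofReal (meanBlock (symbolExponent γ δ a) / 2) := by
  have hδ1 : 1 < δ := by linarith
  have hγ1 : 1 < γ := by linarith
  have hs := one_lt_symbolExponent hδ1 hγ1 a
  have hs2 : 2 < symbolExponent γ δ a := by unfold symbolExponent; split_ifs <;> assumption
  obtain ⟨b, hab⟩ := exists_ne a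
  have h := lintegral_cyl_inter hδ1 hγ1 hν a MeasurableSet.univ (eigenfunction γ δ)
    (fun n x hx => eigenfunction_eq hδ1 hγ1 hx)
  simp only [Set.inter_univ, measure_blockSet hδ1 hγ1 hν hab.symm] at h
  rw [h, measure_cyl hδ1 hγ1 hν, div_eq_mul_inv _ (2 : ℝ), ← (hasSum_blockTail hs2).tsum_eq,
    ← tsum_mul_right, ENNReal.ofReal_tsum_of_nonneg
      (fun n => mul_nonneg (blockTail_nonneg hs n) (by norm_num))
      ((summable_blockTail hs2).mul_right _)]
  refine tsum_congr fun n => ?_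
  have hpos := blockProb_pos hs n
  rw [← mul_assoc, ← ENNReal.ofReal_mul (div_nonneg (blockTail_nonneg hs n) hpos.le),
    div_mul_cancel₀ _ hpos.ne', ENNReal.ofReal_mul (blockTail_nonneg hs n),
    ENNReal.ofReal_inv_of_pos two_pos, ENNReal.ofReal_ofNat, one_div]

theorem lintegral_eigenfunction [IsProbabilityMeasure ν]
    (hδ : 2 < δ) (hγ : 2 < γ) (hν : dualRuelle γ δ ν = ν) :
    ∫⁻ x, eigenfunction γ δ x ∂ν = ENNReal.ofReal ((meanBlock γ + meanBlock δ) / 2) := by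
  have h2 : (cyl 0)ᶜ = cyl 1 := by
    ext x
    change x 0 ≠ 0 ↔ x 0 = 1
    omega
  rw [← lintegral_add_compl _ (measurableSet_cyl 0), h2, lintegral_cyl_eigenfunction hδ hγ hν,
    lintegral_cyl_eigenfunction hδ hγ hν, add_div, ENNReal.ofReal_add
    (half_pos (meanBlock_pos hγ)).le (half_pos (meanBlock_pos hδ)).le]
  rfl

end Conformal

/-! ### Construction of a fixed probability measure -/

theorem prepend_iterate_apply (a : Fin 2) (k : ℕ) (x : Omega) (i : ℕ) :
    (prepend a)^[k] x i = if i < k then a else x (i - k) := by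
  induction k generalizing i with
  | zero => simp
  | succ k ih =>
    rw [Function.iterate_succ_apply']
    cases i with
    | zero => simp [prepend_zero]
    | succ i => rw [prepend_succ, ih]; simp

theorem measurable_prepend_iterate (a : Fin 2) (k : ℕ) : Measurable (prepend a)^[k] :=
  (measurable_prepend a).iterate k

theorem prepend_iterate_mem_blockSet {a : Fin 2} {x : Omega} (hx : x 0 ≠ a) (n : ℕ) :
    (prepend a)^[n + 1] x ∈ blockSet a n := by
  have h0 : (prepend a)^[n + 1] x 0 = a := by rw [prepend_iterate_apply, if_pos n.succ_pos]
  refine ⟨h0, (firstBlock_eq_succ_iff _ n).2 ⟨fun i hi => ?_, ?_⟩⟩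
  · rw [h0, prepend_iterate_apply, if_pos (by omega)]
  · rw [h0, prepend_iterate_apply, if_neg (by omega), Nat.sub_self]
    exact hx

/-- The law of the sequence that consists of a random block of symbols `a`, followed by an
independent sequence with law `ν`. -/
noncomputable def addBlock (s : ℝ) (a : Fin 2) (ν : Measure Omega) : Measure Omega :=
  Measure.sum fun n => ENNReal.ofReal (blockProb s n) • ν.map (prepend a)^[n + 1]

theorem lintegral_addBlock (s : ℝ) (a : Fin 2) (ν : Measure Omega) {ψ : Omega → ℝ≥0∞}
    (hψ : Measurable ψ) : ∫⁻ x, ψ x ∂(addBlock s a ν) =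
      ∑' n, ENNReal.ofReal (blockProb s n) * ∫⁻ x, ψ ((prepend a)^[n + 1] x) ∂ν := by
  rw [addBlock, lintegral_sum_measure]
  refine tsum_congr fun n => ?_
  rw [lintegral_smul_measure, lintegral_map hψ (measurable_prepend_iterate a _), smul_eq_mul]

theorem isProbabilityMeasure_addBlock {s : ℝ} (hs : 1 < s) (a : Fin 2) (ν : Measure Omega)
    [IsProbabilityMeasure ν] : IsProbabilityMeasure (addBlock s a ν) := by
  refine ⟨?_⟩
  rw [← lintegral_one, lintegral_addBlock s a ν measurable_const]
  simp [tsum_ofReal_blockProb hs]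

theorem ae_addBlock (s : ℝ) (a : Fin 2) (ν : Measure Omega) : ∀ᵐ x ∂(addBlock s a ν), x 0 = a := by
  refine (Measure.ae_sum_iff' (measurableSet_cyl a)).2 fun n => Measure.ae_smul_measure ?_ _
  rw [ae_map_iff (measurable_prepend_iterate a _).aemeasurable (measurableSet_cyl a)]
  exact ae_of_all _ fun x => by rw [prepend_iterate_apply, if_pos n.succ_pos]

/-- The two parts of the Ruelle operator applied to a sequence with a random first block. -/
theorem lintegral_branch_add {γ δ : ℝ} (hδ : 1 < δ) (hγ : 1 < γ) {a b : Fin 2} (hab : a ≠ b)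
    {νa νb : Measure Omega} (ha : νa = addBlock (symbolExponent γ δ a) a νb)
    (hb : ∀ᵐ x ∂νb, x 0 = b) {ψ : Omega → ℝ≥0∞} (hψ : Measurable ψ) :
    ∫⁻ x, branchWeight γ δ a x * ψ (prepend a x) ∂νa +
      ∫⁻ x, branchWeight γ δ a x * ψ (prepend a x) ∂νb = ∫⁻ x, ψ x ∂νa := by
  have hs := one_lt_symbolExponent hδ hγ a
  have hm : Measurable fun x => branchWeight γ δ a x * ψ (prepend a x) :=
    (measurable_branchWeight a).mul (hψ.comp (measurable_prepend a))
  -- Prepending `a` to a sequence in `[b]` opens a block of length one, the term `n = 0`; prepending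
  -- it to a block of length `n + 1` gives length `n + 2`, the shifted terms.
  rw [ha, lintegral_addBlock _ _ _ hψ, lintegral_addBlock _ _ _ hm,
    tsum_eq_zero_add' (f := fun n =>
      ENNReal.ofReal (blockProb (symbolExponent γ δ a) n) * ∫⁻ x, ψ ((prepend a)^[n + 1] x) ∂νb)
      ENNReal.summable,
    add_comm]
  congr 1
  · rw [← lintegral_const_mul' _ _ ENNReal.ofReal_ne_top]
    refine lintegral_congr_ae ?_
    filter_upwards [hb] with x hx
    have hx' : x 0 ≠ a := by rw [hx]; exact hab.symm
    have hmem := prepend_iterate_mem_blockSet hx' 0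
    rw [zero_add, Function.iterate_one] at hmem ⊢
    rw [branchWeight, exp_potential_one hδ hγ hmem]
  · refine tsum_congr fun n => ?_
    rw [← lintegral_const_mul' _ _ ENNReal.ofReal_ne_top,
      ← lintegral_const_mul' _ _ ENNReal.ofReal_ne_top]
    refine lintegral_congr_ae ?_
    filter_upwards [hb] with x hx
    have hx' : x 0 ≠ a := by rw [hx]; exact hab.symm
    have hmem := prepend_iterate_mem_blockSet hx' (n + 1)
    have hw := weight_pos (symbolExponent γ δ a) n
    rw [Function.iterate_succ_apply' (prepend a) (n + 1)] at hmem ⊢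
    rw [branchWeight, exp_potential_succ hmem, ← mul_assoc, ← ENNReal.ofReal_mul
      (blockProb_pos hs n).le]
    congr 2
    unfold blockProb
    field_simp

/-- The branch of symbol `0` sends the whole of `ν₀ + ν₁` to `ν₀`, by prolonging blocks of zeros and
opening new ones; the branch of symbol `1` likewise sends it to `ν₁`. -/
theorem dualRuelle_eq_self {γ δ : ℝ} (hδ : 1 < δ) (hγ : 1 < γ) {ν₀ ν₁ : Measure Omega}
    (h0 : ν₀ = addBlock γ 0 ν₁) (h1 : ν₁ = addBlock δ 1 ν₀) (c : ℝ≥0∞) :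
    dualRuelle γ δ (c • (ν₀ + ν₁)) = c • (ν₀ + ν₁) := by
  have ae0 : ∀ᵐ x ∂ν₀, x 0 = 0 := by rw [h0]; exact ae_addBlock _ _ _
  have ae1 : ∀ᵐ x ∂ν₁, x 0 = 1 := by rw [h1]; exact ae_addBlock _ _ _
  refine Measure.ext_of_lintegral _ fun ψ hψ => ?_
  rw [lintegral_dualRuelle _ hψ, Fin.sum_univ_two]
  simp only [lintegral_smul_measure, lintegral_add_measure]
  have e0 := lintegral_branch_add hδ hγ zero_ne_one (νa := ν₀) h0 ae1 hψ
  have e1 := lintegral_branch_add hδ hγ one_ne_zero (νa := ν₁) h1 ae0 hψ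
  rw [e0, add_comm (∫⁻ x, _ ∂ν₀), e1, smul_add]

/-- The law of the length of a block, diminished by one. -/
noncomputable def blockLaw (s : ℝ) : Measure ℕ :=
  Measure.sum fun n => ENNReal.ofReal (blockProb s n) • Measure.dirac n

theorem lintegral_blockLaw (s : ℝ) (f : ℕ → ℝ≥0∞) :
    ∫⁻ n, f n ∂(blockLaw s) = ∑' n, ENNReal.ofReal (blockProb s n) * f n := by
  rw [blockLaw, lintegral_sum_measure]
  refine tsum_congr fun n => ?_
  rw [lintegral_smul_measure, lintegral_dirac, smul_eq_mul]

theorem isProbabilityMeasure_blockLaw {s : ℝ} (hs : 1 < s) :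
    IsProbabilityMeasure (blockLaw s) := by
  refine ⟨?_⟩
  rw [← lintegral_one, lintegral_blockLaw]
  simp [tsum_ofReal_blockProb hs]

/-- The sequence of pairs that begins with `p.1` and continues with `p.2`. -/
def consPair {α : Type*} (p : α × (ℕ → α)) : ℕ → α
  | 0 => p.1
  | n + 1 => p.2 n

theorem measurable_consPair {α : Type*} [MeasurableSpace α] :
    Measurable (consPair : α × (ℕ → α) → ℕ → α) :=
  measurable_pi_lambda _ fun n => by
    cases n with
    | zero => exact measurable_fst
    | succ n => exact (measurable_pi_apply n).comp measurable_snd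

/-- The first term of an i.i.d. sequence is independent of the rest, which is i.i.d. again. -/
theorem map_consPair_prod_infinitePi {α : Type*} [MeasurableSpace α] (μ : Measure α)
    [IsProbabilityMeasure μ] :
    (μ.prod (Measure.infinitePi fun _ : ℕ => μ)).map consPair =
      Measure.infinitePi fun _ : ℕ => μ := by
  classical
  refine Measure.eq_infinitePi _ fun s t ht => ?_
  have hmt : ∀ i, MeasurableSet (if i ∈ s then t i else Set.univ) := fun i => by
    split_ifs with h
    · exact ht i
    · exact MeasurableSet.univ
  obtain ⟨N, hN⟩ : ∃ N, s ⊆ Finset.range (N + 1) :=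
    ⟨s.sup id, fun i hi => Finset.mem_range.2 (Nat.lt_succ_of_le (Finset.le_sup (f := id) hi))⟩
  set u : ℕ → Set α := fun i => if i ∈ s then t i else Set.univ with hu
  have hpi : consPair ⁻¹' Set.pi (s : Set ℕ) t =
      u 0 ×ˢ Set.pi (Finset.range N : Set ℕ) fun i => u (i + 1) := by
    ext p
    simp only [Set.mem_preimage, Set.mem_pi, Finset.mem_coe, Set.mem_prod, Finset.mem_range]
    constructor
    · intro h
      refine ⟨?_, fun i _ => ?_⟩
      · by_cases h0 : 0 ∈ s
        · simp only [hu, if_pos h0]; exact h 0 h0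
        · simp only [hu, if_neg h0]; trivial
      · by_cases h0 : i + 1 ∈ s
        · simp only [hu, if_pos h0]; exact h (i + 1) h0
        · simp only [hu, if_neg h0]; trivial
    · rintro ⟨h0, h⟩ i hi
      cases i with
      | zero =>
        simp only [hu, if_pos hi] at h0
        exact h0
      | succ i =>
        have := h i (Nat.succ_lt_succ_iff.1 (Finset.mem_range.1 (hN hi)))
        simp only [hu, if_pos hi] at this
        exact this
  rw [Measure.map_apply measurable_consPair (MeasurableSet.pi s.countable_toSet fun i _ => ht i),
    hpi, Measure.prod_prod, Measure.infinitePi_pi (fun _ => μ) (fun i _ => hmt (i + 1)), mul_comm,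
    ← Finset.prod_range_succ' (fun i => μ (u i)) N]
  rw [← Finset.prod_subset hN fun i _ hi => by simp only [hu, if_neg hi, measure_univ]]
  exact Finset.prod_congr rfl fun i hi => by simp only [hu, if_pos hi]

/-- The sequence whose successive blocks have the lengths `(ω 0).1 + 1` (symbols `0`),
`(ω 0).2 + 1` (symbols `1`), `(ω 1).1 + 1` (symbols `0`), … -/
def code (ω : ℕ → ℕ × ℕ) (i : ℕ) : Fin 2 :=
  if i < (ω 0).1 + 1 then 0
  else if i - ((ω 0).1 + 1) < (ω 0).2 + 1 then 1
  else code (fun n => ω (n + 1)) (i - ((ω 0).1 + 1) - ((ω 0).2 + 1))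
termination_by i
decreasing_by omega

theorem code_consPair (p : (ℕ × ℕ) × (ℕ → ℕ × ℕ)) :
    code (consPair p) = (prepend 0)^[p.1.1 + 1] ((prepend 1)^[p.1.2 + 1] (code p.2)) := by
  ext i
  rw [code, prepend_iterate_apply, prepend_iterate_apply]
  rfl

theorem measurable_code : Measurable code := by
  refine measurable_pi_lambda _ fun i => ?_
  induction i using Nat.strong_induction_on with
  | _ i ih =>
    have h : (fun ω => code ω i) = fun ω : ℕ → ℕ × ℕ =>
        if i < (ω 0).1 + 1 then 0 else if i - ((ω 0).1 + 1) < (ω 0).2 + 1 then 1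
          else code (fun n => ω (n + 1)) (i - ((ω 0).1 + 1) - ((ω 0).2 + 1)) := by
      ext ω; rw [code]
    rw [h]
    have hm : Measurable fun ω : ℕ → ℕ × ℕ => (ω 0, fun n => ω (n + 1)) :=
      (measurable_pi_apply 0).prodMk (measurable_pi_lambda _ fun n => measurable_pi_apply (n + 1))
    suffices hs : Measurable fun p : (ℕ × ℕ) × (ℕ → ℕ × ℕ) =>
        (if i < p.1.1 + 1 then 0 else if i - (p.1.1 + 1) < p.1.2 + 1 then 1
          else code p.2 (i - (p.1.1 + 1) - (p.1.2 + 1)) : Fin 2) from hs.comp hm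
    refine measurable_from_prod_countable_right fun p => ?_
    by_cases h1 : i < p.1 + 1
    · simp only [h1, if_true]; exact measurable_const
    · by_cases h2 : i - (p.1 + 1) < p.2 + 1
      · simp only [h1, h2, if_true, if_false]; exact measurable_const
      · simp only [h1, h2, if_false]
        exact ih _ (by omega)

/-- The dual of the Ruelle operator has a fixed probability measure. -/
theorem exists_dualRuelle_eq_self {γ δ : ℝ} (hδ : 1 < δ) (hγ : 1 < γ) :
    ∃ ν : Measure Omega, IsProbabilityMeasure ν ∧ dualRuelle γ δ ν = ν := by
  have := isProbabilityMeasure_blockLaw hδ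
  have := isProbabilityMeasure_blockLaw hγ
  set P := Measure.infinitePi fun _ : ℕ => (blockLaw γ).prod (blockLaw δ) with hP
  have hprob : IsProbabilityMeasure (P.map code) :=
    Measure.isProbabilityMeasure_map measurable_code.aemeasurable
  have hprob' := isProbabilityMeasure_addBlock hδ 1 (P.map code)
  -- Splitting the first pair off the i.i.d. sequence shows that its coded law is unchanged by
  -- adding a block of ones and then a block of zeros.
  have h0 : P.map code = addBlock γ 0 (addBlock δ 1 (P.map code)) := by
    refine Measure.ext_of_lintegral _ fun ψ hψ => ?_
    have hmeas : Measurable fun p : (ℕ × ℕ) × (ℕ → ℕ × ℕ) => ψ (code (consPair p)) :=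
      hψ.comp (measurable_code.comp measurable_consPair)
    rw [lintegral_addBlock _ _ _ hψ]
    conv_lhs => rw [hP, ← map_consPair_prod_infinitePi, ← hP]
    rw [lintegral_map hψ measurable_code,
      lintegral_map (f := fun ω => ψ (code ω)) (hψ.comp measurable_code)
      measurable_consPair, lintegral_prod _ hmeas.aemeasurable,
      lintegral_prod _ (measurable_of_countable _).aemeasurable, lintegral_blockLaw]
    refine tsum_congr fun n => ?_
    rw [lintegral_blockLaw, lintegral_addBlock (ψ := fun x => ψ ((prepend 0)^[n + 1] x)) _ _ _
      (hψ.comp (measurable_prepend_iterate 0 _))]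
    congr 1
    refine tsum_congr fun m => ?_
    rw [lintegral_map (f := fun x => ψ ((prepend 0)^[n + 1] ((prepend 1)^[m + 1] x)))
      ((hψ.comp (measurable_prepend_iterate 0 _)).comp
      (measurable_prepend_iterate 1 _)) measurable_code]
    simp only [code_consPair]
  refine ⟨(2 : ℝ≥0∞)⁻¹ • (P.map code + addBlock δ 1 (P.map code)), ⟨?_⟩,
    dualRuelle_eq_self hδ hγ h0 rfl _⟩
  rw [Measure.smul_apply, Measure.add_apply, measure_univ, measure_univ, smul_eq_mul,
    one_add_one_eq_two, ENNReal.inv_mul_cancel (by norm_num) (by norm_num)]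

/-! ### The equilibrium measure and its correlations -/

section Equilibrium

variable {γ δ : ℝ} {ν : Measure Omega}

/-- The equilibrium measure attached to a fixed measure of the dual of the Ruelle operator. -/
noncomputable def equilibrium (γ δ : ℝ) (ν : Measure Omega) : Measure Omega :=
  (∫⁻ x, eigenfunction γ δ x ∂ν)⁻¹ • ν.withDensity (eigenfunction γ δ)

theorem equilibrium_apply (ν : Measure Omega) {S : Set Omega} (hS : MeasurableSet S) :
    equilibrium γ δ ν S =
      (∫⁻ x, eigenfunction γ δ x ∂ν)⁻¹ * ∫⁻ x in S, eigenfunction γ δ x ∂ν := by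
  rw [equilibrium, Measure.smul_apply, withDensity_apply _ hS, smul_eq_mul]

theorem isProbabilityMeasure_equilibrium [IsProbabilityMeasure ν] (hδ : 2 < δ) (hγ : 2 < γ)
    (hν : dualRuelle γ δ ν = ν) : IsProbabilityMeasure (equilibrium γ δ ν) := by
  refine ⟨?_⟩
  rw [equilibrium_apply ν MeasurableSet.univ, Measure.restrict_univ,
    lintegral_eigenfunction hδ hγ hν]
  have := meanBlock_pos hδ
  have := meanBlock_pos hγ
  exact ENNReal.inv_mul_cancel (ENNReal.ofReal_pos.2 (by linarith)).ne' ENNReal.ofReal_ne_top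

/-- With `𝓛* ν = ν` and `𝓛 φ = φ`, one has `∫ (ψ ∘ σ) φ dν = ∫ 𝓛((ψ ∘ σ) φ) dν = ∫ ψ 𝓛φ dν = ∫ ψ φ
dν`. -/
theorem measurePreserving_equilibrium (hδ : 1 < δ) (hγ : 1 < γ) (hν : dualRuelle γ δ ν = ν) :
    MeasurePreserving shift (equilibrium γ δ ν) (equilibrium γ δ ν) := by
  have hφ := measurable_eigenfunction hδ hγ
  refine ⟨measurable_shift, ?_⟩
  rw [equilibrium, Measure.map_smul]
  congr 1
  refine Measure.ext_of_lintegral _ fun ψ hψ => ?_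
  rw [lintegral_map hψ measurable_shift, lintegral_withDensity_eq_lintegral_mul _ hφ hψ,
    lintegral_withDensity_eq_lintegral_mul _ hφ (g := fun x => ψ (shift x))
      (hψ.comp measurable_shift)]
  conv_lhs => rw [← hν]
  rw [lintegral_dualRuelle (ψ := eigenfunction γ δ * fun x => ψ (shift x)) _
    (hφ.mul (hψ.comp measurable_shift)), ← lintegral_finsetSum]
  · refine lintegral_congr fun x => ?_
    rw [Pi.mul_apply, ← sum_branchWeight_mul_eigenfunction hδ hγ x, Finset.sum_mul]
    refine Finset.sum_congr rfl fun a _ => ?_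
    rw [Pi.mul_apply, shift_prepend, mul_assoc]
  · exact fun a _ => (measurable_branchWeight a).mul
      ((hφ.mul (hψ.comp measurable_shift)).comp (measurable_prepend a))

theorem correlation_eq {μ : Measure Omega} [IsProbabilityMeasure μ]
    (hμ : MeasurePreserving shift μ μ) (q : ℕ) :
    correlation μ q = μ.real (cyl 0 ∩ zeroAt q) - μ.real (cyl 0) ^ 2 := by
  have h1 : ∀ x, cylZero.indicator (fun _ => (1 : ℝ)) (shift^[q] x) =
      (zeroAt q).indicator (fun _ => (1 : ℝ)) x := fun x => by
    have : shift^[q] x ∈ cylZero ↔ x ∈ zeroAt q := by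
      change shift^[q] x 0 = 0 ↔ x q = 0
      rw [shift_iterate_apply, zero_add]
    by_cases hx : x ∈ zeroAt q
    · rw [Set.indicator_of_mem hx, Set.indicator_of_mem (this.2 hx)]
    · rw [Set.indicator_of_notMem hx, Set.indicator_of_notMem fun h => hx (this.1 h)]
  have h2 : ∀ x, cylZero.indicator (fun _ => (1 : ℝ)) (shift^[q] x) *
      (cylZero.indicator (fun _ => (1 : ℝ)) x - μ.real cylZero) =
      (cyl 0 ∩ zeroAt q).indicator (fun _ => (1 : ℝ)) x -
        (zeroAt q).indicator (fun _ => (1 : ℝ)) x * μ.real (cyl 0) := fun x => by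
    rw [h1, mul_sub, ← Set.inter_indicator_mul, Set.inter_comm]
    simp only [mul_one]
    rfl
  have h3 : μ.real (zeroAt q) = μ.real (cyl 0) := by
    have h := (hμ.iterate q).measure_preimage (measurableSet_cyl 0).nullMeasurableSet
    have h' : shift^[q] ⁻¹' cyl 0 = zeroAt q := by
      ext x
      change shift^[q] x 0 = 0 ↔ x q = 0
      rw [shift_iterate_apply, zero_add]
    rw [measureReal_def, measureReal_def, ← h, h']
  have hm := (measurableSet_cyl 0).inter (measurableSet_zeroAt q)
  rw [correlation]
  simp only [h2]
  rw [integral_sub ((integrable_const 1).indicator hm)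
    (((integrable_const 1).indicator (measurableSet_zeroAt q)).mul_const _), integral_mul_const,
    integral_indicator_const _ hm, integral_indicator_const _ (measurableSet_zeroAt q), h3]
  simp [pow_two]

theorem equilibrium_real_cyl [IsProbabilityMeasure ν] (hδ : 2 < δ) (hγ : 2 < γ)
    (hν : dualRuelle γ δ ν = ν) :
    (equilibrium γ δ ν).real (cyl 0) = meanBlock γ / (meanBlock γ + meanBlock δ) := by
  have h1 := meanBlock_pos hδ
  have h2 := meanBlock_pos hγ
  rw [measureReal_def, equilibrium_apply ν (measurableSet_cyl 0),
    lintegral_eigenfunction hδ hγ hν, lintegral_cyl_eigenfunction hδ hγ hν, ENNReal.toReal_mul,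
    ENNReal.toReal_inv, ENNReal.toReal_ofReal (by linarith)]
  change _ * (ENNReal.ofReal (meanBlock γ / 2)).toReal = _
  rw [ENNReal.toReal_ofReal (by linarith)]
  field_simp

/-- The integral of the eigenfunction over the sequences whose zeroth and `q`-th symbols are `0`. -/
noncomputable def weightedHit (γ : ℝ) (ν : Measure Omega) (q : ℕ) : ℝ :=
  (∑' j, blockTail γ (q + j)) * (1 / 2) +
    cf (PowerSeries.X * (tailSeries γ * PowerSeries.mk (hit ν 1))) q

theorem weightedHit_nonneg (hγ : 1 < γ) (ν : Measure Omega) (q : ℕ) :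
    0 ≤ weightedHit γ ν q := by
  refine add_nonneg (mul_nonneg (tsum_nonneg fun j => blockTail_nonneg hγ _) (by norm_num)) ?_
  cases q with
  | zero => simp [cf]
  | succ q =>
    rw [cf, PowerSeries.coeff_succ_X_mul, PowerSeries.coeff_mul]
    refine Finset.sum_nonneg fun p _ => mul_nonneg ?_ ?_
    · rw [tailSeries, PowerSeries.coeff_mk]; exact blockTail_nonneg hγ _
    · rw [PowerSeries.coeff_mk]; exact hit_nonneg _ _

theorem equilibrium_real_inter [IsProbabilityMeasure ν] (hδ : 2 < δ) (hγ : 2 < γ)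
    (hν : dualRuelle γ δ ν = ν) (q : ℕ) :
    (equilibrium γ δ ν).real (cyl 0 ∩ zeroAt q) =
      2 * weightedHit γ ν q / (meanBlock γ + meanBlock δ) := by
  have h1 := meanBlock_pos hδ
  have h2 := meanBlock_pos hγ
  rw [measureReal_def, equilibrium_apply ν ((measurableSet_cyl 0).inter (measurableSet_zeroAt q)),
    lintegral_eigenfunction hδ hγ hν, lintegral_eigenfunction_eq hδ hγ hν zero_ne_one,
    hit_zero_zero (by linarith) (by linarith) hν, ENNReal.toReal_mul,
    ENNReal.toReal_inv, ENNReal.toReal_ofReal (by linarith)]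
  change _ * (ENNReal.ofReal (weightedHit γ ν q)).toReal = _
  rw [ENNReal.toReal_ofReal (weightedHit_nonneg (by linarith) ν q)]
  field_simp

/-- The renewal equations determine the generating function of `weightedHit`. -/
theorem one_sub_X_mul_weightedHit [IsProbabilityMeasure ν] (hδ : 2 < δ) (hγ : 2 < γ)
    (hν : dualRuelle γ δ ν = ν) :
    (1 - PowerSeries.X) * (2 * PowerSeries.mk (weightedHit γ ν)) =
      PowerSeries.C (meanBlock γ) - PowerSeries.X * correlationSeries γ δ := by
  have hδ1 : 1 < δ := by linarith
  have hγ1 : 1 < γ := by linarith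
  set J₀ := PowerSeries.mk (hit ν 0) with hJ₀
  set J₁ := PowerSeries.mk (hit ν 1) with hJ₁
  set T₂ : PowerSeries ℝ := PowerSeries.mk fun q => ∑' j, blockTail γ (q + j) with hT₂
  set half : PowerSeries ℝ := PowerSeries.C (1 / 2) with hhalf
  have h2half : 2 * half = 1 := by
    rw [hhalf, show (2 : PowerSeries ℝ) = PowerSeries.C 2 from (map_ofNat _ 2).symm, ← map_mul]
    norm_num
  have e0 : J₀ = tailSeries γ * half + blockSeries γ * J₁ := by
    ext q
    rw [map_add, hhalf, PowerSeries.coeff_mul_C, hJ₀, PowerSeries.coeff_mk,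
      hit_eq hδ1 hγ1 hν zero_ne_one, hit_zero_zero hδ1 hγ1 hν, tailSeries, PowerSeries.coeff_mk]
    rfl
  have e1 : J₁ = blockSeries δ * J₀ := by
    ext q
    rw [hJ₁, PowerSeries.coeff_mk, hit_eq hδ1 hγ1 hν one_ne_zero, hit_one_zero, mul_zero, zero_add]
    rfl
  have eW : PowerSeries.mk (weightedHit γ ν) =
      T₂ * half + PowerSeries.X * (tailSeries γ * J₁) := by
    ext q
    rw [map_add, hhalf, PowerSeries.coeff_mul_C, hT₂, PowerSeries.coeff_mk, PowerSeries.coeff_mk]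
    rfl
  have eT : (1 - PowerSeries.X) * T₂ =
      PowerSeries.C (meanBlock γ) - PowerSeries.X * tailSeries γ := by
    ext q
    rw [sub_mul, one_mul, map_sub, map_sub]
    cases q with
    | zero =>
      simp [hT₂, (hasSum_blockTail hγ).tsum_eq]
    | succ q =>
      have hs : Summable fun j => blockTail γ (q + j) := by
        simpa only [add_comm] using (summable_nat_add_iff q).2 (summable_blockTail hγ)
      rw [PowerSeries.coeff_succ_X_mul, PowerSeries.coeff_succ_X_mul, PowerSeries.coeff_C,
        if_neg q.succ_ne_zero, hT₂, PowerSeries.coeff_mk, PowerSeries.coeff_mk, tailSeries,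
        PowerSeries.coeff_mk, hs.tsum_eq_zero_add]
      simp only [add_zero, add_assoc, add_comm 1]
      ring
  have hD0 := constantCoeff_pairSeries hδ1 hγ1
  have hD : pairSeries γ δ ≠ 0 := fun h => hD0 (by rw [h, map_zero])
  have hK : pairSeries γ δ * correlationSeries γ δ = tailSeries γ * tailSeries δ := by
    rw [correlationSeries, mul_left_comm, PowerSeries.mul_inv_cancel _ hD0, mul_one]
  have hJ : (1 - PowerSeries.X) * pairSeries γ δ * J₀ = tailSeries γ * half := by
    rw [one_sub_X_mul_pairSeries hδ1 hγ1, sub_mul, one_mul]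
    nth_rw 1 [e0]
    rw [e1]
    ring
  -- Multiplication by `D` clears the denominator of `K`. Then `eT` eliminates the double tail `T₂`,
  -- `hJ` eliminates `J₀`, `hK` eliminates `K`, and `h2half` cancels the factors `2` and `1/2`.
  refine mul_left_cancel₀ hD ?_
  rw [eW, e1, blockSeries_eq hδ1]
  have hpair : pairSeries γ δ = tailSeries γ + tailSeries δ -
    (1 - PowerSeries.X) * (tailSeries γ * tailSeries δ) := rfl
  linear_combination (pairSeries γ δ * 2 * half) * eT +
    2 * PowerSeries.X * tailSeries γ * (1 - (1 - PowerSeries.X) * tailSeries δ) * hJ +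
    PowerSeries.X * hK + (pairSeries γ δ * (PowerSeries.C (meanBlock γ) -
      PowerSeries.X * tailSeries γ) + PowerSeries.X * tailSeries γ * tailSeries γ *
      (1 - (1 - PowerSeries.X) * tailSeries δ)) * h2half -
    PowerSeries.X * tailSeries γ * hpair

theorem two_mul_weightedHit_eq [IsProbabilityMeasure ν] (hδ : 2 < δ) (hγ : 2 < γ)
    (hν : dualRuelle γ δ ν = ν) (q : ℕ) :
    2 * weightedHit γ ν q =
      meanBlock γ - ∑ n ∈ Finset.range q, cf (correlationSeries γ δ) n := by
  have h := one_sub_X_mul_weightedHit hδ hγ hν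
  have h2 : (2 : PowerSeries ℝ) * PowerSeries.mk (weightedHit γ ν) =
      PowerSeries.mk fun q => 2 * weightedHit γ ν q := by
    ext q
    rw [show (2 : PowerSeries ℝ) = PowerSeries.C 2 from (map_ofNat _ 2).symm,
      PowerSeries.coeff_C_mul, PowerSeries.coeff_mk, PowerSeries.coeff_mk]
  rw [h2, sub_mul, one_mul] at h
  induction q with
  | zero => simpa using congrArg (PowerSeries.coeff 0) h
  | succ q ih =>
    have h3 := congrArg (PowerSeries.coeff (q + 1)) h
    rw [map_sub, map_sub, PowerSeries.coeff_succ_X_mul, PowerSeries.coeff_succ_X_mul,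
      PowerSeries.coeff_C, if_neg q.succ_ne_zero, PowerSeries.coeff_mk, PowerSeries.coeff_mk] at h3
    rw [Finset.sum_range_succ]
    linarith

/-- The total of `K` turns `m_γ - ∑ K_n` into `m_γ² / (m_γ + m_δ)`, which after normalization is the
square of the measure of `[0]`. Only the tail of `K` survives. -/
theorem correlation_equilibrium_eq [IsProbabilityMeasure ν] (hδ : 2 < δ) (hγ : δ < γ)
    (hν : dualRuelle γ δ ν = ν) (q : ℕ) :
    correlation (equilibrium γ δ ν) q =
      (∑' j, cf (correlationSeries γ δ) (q + j)) / (meanBlock γ + meanBlock δ) := by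
  have hγ2 : 2 < γ := hδ.trans hγ
  have := isProbabilityMeasure_equilibrium hδ hγ2 hν
  have h1 := meanBlock_pos hδ
  have h2 := meanBlock_pos hγ2
  have hK := ((decays_correlationSeries hδ hγ).summable (by linarith)).of_norm
  have hsum := hK.sum_add_tsum_nat_add q
  have htot := total_correlationSeries hδ hγ2
  rw [total, ← hsum] at htot
  rw [correlation_eq (measurePreserving_equilibrium (by linarith) (by linarith) hν),
    equilibrium_real_inter hδ hγ2 hν, equilibrium_real_cyl hδ hγ2 hν,
    two_mul_weightedHit_eq hδ hγ2 hν]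
  simp only [add_comm q]
  rw [eq_sub_of_add_eq' htot]
  field_simp
  ring

/-- The limit of the correlations, divided by `q ^ (2 - δ)`. -/
noncomputable def correlationLimit (γ δ : ℝ) : ℝ :=
  meanBlock γ ^ 2 * (1 / (δ - 1) / zeta δ) / (meanBlock γ + meanBlock δ) ^ 2 / (δ - 2) /
    (meanBlock γ + meanBlock δ)

theorem correlationLimit_pos (hδ : 2 < δ) (hγ : 2 < γ) : 0 < correlationLimit γ δ := by
  have h1 := meanBlock_pos hδ
  have h2 := meanBlock_pos hγ
  have h3 := zeta_pos (s := δ) (by linarith)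
  have h4 : 0 < δ - 1 := by linarith
  have h5 : 0 < δ - 2 := by linarith
  unfold correlationLimit
  positivity

theorem tendsto_correlation_equilibrium [IsProbabilityMeasure ν] (hδ : 2 < δ) (hγ : δ < γ)
    (hν : dualRuelle γ δ ν = ν) :
    Tendsto (fun q : ℕ => correlation (equilibrium γ δ ν) q / (q : ℝ) ^ (2 - δ)) atTop
      (𝓝 (correlationLimit γ δ)) := by
  have h := ((decays_correlationSeries hδ hγ).tail (by linarith)).div_const
    (meanBlock γ + meanBlock δ)
  rw [show δ - 1 - 1 = δ - 2 by ring] at h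
  -- The weight is a power of `q + 1`; this factor converts it to the same power of `q`.
  have h2 := tendsto_natCast_div_natCast_add_one.rpow_const (p := δ - 2) (Or.inl one_ne_zero)
  rw [Real.one_rpow] at h2
  have h3 := h.mul h2
  rw [mul_one] at h3
  refine h3.congr' ?_
  filter_upwards [eventually_gt_atTop 0] with q hq
  have hq0 : (0 : ℝ) < q := by exact_mod_cast hq
  rw [correlation_equilibrium_eq hδ hγ hν, Real.div_rpow hq0.le (by positivity), weight,
    Real.rpow_neg (by positivity), show 2 - δ = -(δ - 2) by ring, Real.rpow_neg hq0.le]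
  have h4 : (0 : ℝ) < ((q : ℝ) + 1) ^ (δ - 2) := by positivity
  field_simp

end Equilibrium

end DoubleHofbauer

theorem mainTheorem6 (γ δ : ℝ) (hδ : 2 < δ) (hγ : δ < γ) :
    (∃ μ : Measure DoubleHofbauer.Omega, DoubleHofbauer.IsCriticalEquilibrium γ δ μ) ∧
    ∃ C : ℝ, 0 < C ∧
      ∀ μ : Measure DoubleHofbauer.Omega, DoubleHofbauer.IsCriticalEquilibrium γ δ μ →
        IsProbabilityMeasure μ ∧ MeasurePreserving DoubleHofbauer.shift μ μ ∧
        Tendsto (fun q : ℕ => DoubleHofbauer.correlation μ q / (q : ℝ) ^ (2 - δ))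
          atTop (𝓝 C) := by
  have hγ2 : 2 < γ := hδ.trans hγ
  have hδ1 : 1 < δ := by linarith
  have hγ1 : 1 < γ := by linarith
  obtain ⟨ν, hprob, hν⟩ := DoubleHofbauer.exists_dualRuelle_eq_self hδ1 hγ1
  refine ⟨⟨_, ν, hprob, (DoubleHofbauer.isRuelleFixed_iff hδ1 hγ1).2 hν, rfl⟩,
    DoubleHofbauer.correlationLimit γ δ, DoubleHofbauer.correlationLimit_pos hδ hγ2, ?_⟩
  rintro _ ⟨ν', hprob', hfix, rfl⟩
  have hν' := (DoubleHofbauer.isRuelleFixed_iff hδ1 hγ1).1 hfix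
  exact ⟨DoubleHofbauer.isProbabilityMeasure_equilibrium hδ hγ2 hν',
    DoubleHofbauer.measurePreserving_equilibrium hδ1 hγ1 hν',
    DoubleHofbauer.tendsto_correlation_equilibrium hδ hγ hν'⟩
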